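/- Setup. Fix $\rho\in[0,1]$ and $k,d\in\mathbb N$. In the task *Nearest of $k$ Neighbors*, Alice receives $X'=(x_1,\dots,x_k)$, i.i.d. uniform in $\{0,1\}^d$; an index $j^*\in[k]$ is uniform and independent of $X'$; Bob receives $z\sim \mathrm{BSC}_{(1-\rho)/2}(x_{j^*})$, i.e. every bit of $x_{j^*}$ is flipped independently with probability $\frac{1-\rho}2$, and has to output $j^*$. In the task $\mathrm{Singletons}(k,q_{HC})$, clusters $C_1,\dots,C_k$ are drawn i.i.d. from $q_{HC}$: every index $i\in[d]$ of a cluster is fixed independently with probability $\rho$ and then gets a fair random value $b(i)$; a sample from a cluster equals $b(i)$ at its fixed indices and is an independent fair bit at all others. Alice receives $X'=(x_1,\dots,x_k)$ with one sample $x_j$ from each $C_j$, and Bob receives a fresh sample $z$ from $C_{j^*}$, with $j^*\in[k]$ uniform, and has to output $j^*$. In a one-way protocol (equivalently, a learning algorithm) Alice sends one message $M$, a randomized function of $X'$, in an arbitrary measurable space, and Bob outputs a randomized function of $(M,z)$; the two use independent private randomness. The error is the probability that the output differs from $j^*$; the optimal error of a task is the infimum of the error over all protocols; a protocol is $\epsilon$-suboptimal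 if its error is at most the optimal error plus $\epsilon$. Mutual information $I$ is measured in bits. Statement. For every constant $a>1$ there are a constant $c_a\in(0,1)$ and functions $o_1,o_2:\mathbb N\to\mathbb R$ with $o_1(k),o_2(k)=O(1/\log k)$ as $k\to\infty$ (all depending only on $a$) such that, with $\rho=\rho(a,k,d)=\sqrt{\frac{2\ln (ak)-\ln\ln k}{d}}$: 1. The optimal errors of Nearest of $k$ Neighbors and of $\mathrm{Singletons}(k,q_{HC})$ are $c_a+o(1)$ as $k\to\infty$, uniformly over all $d\ge k^{0.1}$. 2. For all sufficiently large $k$ (depending only on $a$), all $d\ge k^{0.1}$ and all $\epsilon_k\ge 0$, every one-way protocol that is $\epsilon_k$-suboptimal for Nearest of $k$ Neighbors (in particular, every protocol with error at most $\epsilon_k$) satisfies $$I(X';M)\;\ge\;\frac{1-c_a-\epsilon_k-o_1(k)}{2\ln 2+o_2(k)}\cdot kd .$$ 3. For the same $k,d,\epsilon_k$, every algorithm that is $\epsilon_k$-suboptimal on $\mathrm{Singletons}(k,q_{HC})$ is $\epsilon_k$-suboptimal for Nearest of $k$ Neighbors with the same information cost $I(X';M)$, and hence satisfies the same lower bound.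 -/

import Mathlib

open MeasureTheory ProbabilityTheory Filter
open scoped ENNReal

namespace OneWay

noncomputable section

/-- Binary strings of length `d`. -/
abbrev Cube (d : ℕ) : Type := Fin d → Bool

/-- A coin that is `true` with probability `p` (with `p` clipped to `[0, 1]`). -/
def coin (p : ℝ) : Measure Bool :=
  bernoulliMeasure true false (Set.projIcc 0 1 zero_le_one p)

/-- Output law of the binary symmetric channel: every bit of `x` is flipped independently with
probability `p`. -/
def bsc {d : ℕ} (p : ℝ) (x : Cube d) : Measure (Cube d) :=
  Measure.pi fun i => (coin p).map fun flip => xor (x i) flip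

/-- A one-way task with `k` examples in `{0,1}^d`: the joint law of Alice's examples `x₁, …, x_k`,
the hidden index `j*` that Bob has to output, and Bob's string `z`. -/
abbrev Task (k d : ℕ) : Type := Measure ((Fin k → Cube d) × Fin k × Cube d)

/-- Nearest of `k` Neighbors: `x₁, …, x_k` are i.i.d. uniform, `j*` is uniform, and `z` is
the output of the binary symmetric channel with parameter `(1 - ρ) / 2` on input `x_{j*}`. -/
def nearestNeighbors (k d : ℕ) (ρ : ℝ) : Task k d :=
  (Measure.pi fun _ : Fin k => uniformOn (Set.univ : Set (Cube d))).bind fun X =>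
    (uniformOn (Set.univ : Set (Fin k))).bind fun j =>
      (bsc ((1 - ρ) / 2) (X j)).map fun z => (X, j, z)

/-- The parameters of a hypercube cluster: the first component at `i` says whether the index `i`
is fixed, the second one is the fixed value `b(i)` (which is only used at fixed indices). -/
abbrev Cluster (d : ℕ) : Type := Fin d → Bool × Bool

/-- The component distribution `q_HC`: every index is fixed independently with probability `ρ`,
with a fair fixed value. -/
def qHC (d : ℕ) (ρ : ℝ) : Measure (Cluster d) :=
  Measure.pi fun _ => (coin ρ).prod (coin (1 / 2))

/-- A sample from a cluster: fixed indices carry their fixed value, all others a fair coin. -/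
def sampleHC {d : ℕ} (C : Cluster d) : Measure (Cube d) :=
  Measure.pi fun i => if (C i).1 then Measure.dirac (C i).2 else coin (1 / 2)

/-- Singletons(`k`, `q_HC`): `k` clusters are drawn i.i.d. from `q_HC`, one example `x_j` is drawn
from every cluster `j` (its label `j` is its position in the list), and the test point `z`, whose
label is to be predicted, is a fresh sample from the cluster of a uniform index `j*`. -/
def singletonsHC (k d : ℕ) (ρ : ℝ) : Task k d :=
  (Measure.pi fun _ : Fin k => qHC d ρ).bind fun C =>
    (Measure.pi fun j => sampleHC (C j)).bind fun X =>
      (uniformOn (Set.univ : Set (Fin k))).bind fun j =>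
        (sampleHC (C j)).map fun z => (X, j, z)

/-- A one-way protocol with private randomness (equivalently, a randomized learning algorithm
together with the randomized predictions of its models): Alice sends a random message that depends
on her examples, and Bob outputs a random index that depends on the message and on his string. -/
structure Protocol (k d : ℕ) where
  /-- the space of messages -/
  Msg : Type
  /-- the events about messages -/
  [mMsg : MeasurableSpace Msg]
  /-- Alice's randomized message -/
  alice : Kernel (Fin k → Cube d) Msg
  [markov_alice : IsMarkovKernel alice]
  /-- Bob's randomized output -/
  bob : Kernel (Msg × Cube d) (Fin k)
  [markov_bob : IsMarkovKernel bob]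

attribute [instance] Protocol.mMsg Protocol.markov_alice Protocol.markov_bob

namespace Protocol

variable {k d : ℕ}

/-- The probability that Bob's output differs from the hidden index. -/
def err (P : Protocol k d) (T : Task k d) : ℝ :=
  (∫⁻ ω, ∫⁻ m, P.bob (m, ω.2.2) {ω.2.1}ᶜ ∂(P.alice ω.1) ∂T).toReal

/-- The mutual information `I(X'; M)`, in bits, between Alice's examples and her message: the
Kullback-Leibler divergence of their joint law from the product of its marginals. -/
def info (P : Protocol k d) (T : Task k d) : ℝ≥0∞ :=
  InformationTheory.klDiv (T.fst ⊗ₘ P.alice) (T.fst.prod (P.alice ∘ₘ T.fst)) /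
    ENNReal.ofReal (Real.log 2)

end Protocol

/-- The optimal error for a task. -/
def optErr {k d : ℕ} (T : Task k d) : ℝ := ⨅ P : Protocol k d, P.err T

/-- The error of the protocol is within `ε` of the optimal error for the task. -/
def Protocol.IsSuboptimal {k d : ℕ} (P : Protocol k d) (T : Task k d) (ε : ℝ) : Prop :=
  P.err T ≤ optErr T + ε

/-- The parameter `ρ = √((2 ln(ak) - ln ln k) / d)`. -/
def rho (a : ℝ) (k d : ℕ) : ℝ :=
  √((2 * Real.log (a * k) - Real.log (Real.log k)) / d)

end

end OneWay

namespace OneWay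

noncomputable section

/-! The constant is 1/2 for every `a`. Two samples of one hypercube cluster are uniform and agree at
each index independently with probability ρ + (1 - ρ)/2, exactly like input and output of the
channel. Hence both tasks are the same joint law (`singletonsHC_eq_nearestNeighbors`), and only
Nearest of k Neighbors has to be studied.

Information bound. The strong data processing inequality of the channel is used in its dual form
`exp_noise_le`: for uniform x, the mean of exp(ρ⁻² · (φ averaged over the noise of x)) is at most
(mean of exp φ)^(ρ⁻²). It tensorizes, and for one bit it reduces to cosh(w/ρ) ≤ cosh(w)^(1/ρ²). In
the Donsker-Varadhan bound `ofReal_le_klDiv` take as test function the sum over j of ρ⁻² ln k times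
the noise average of Bob's probability of output j. Under the joint law its mean is ρ⁻² k ln k times
the success probability. Under the product law the examples are independent for a fixed message, and
since Bob's probabilities sum to 1, the exponential moment is at most exp((k - 1)ρ⁻²). Thus the
information in nats is at least ρ⁻²(k · success · ln k - (k - 1)) (`Protocol.le_klDiv_of_success`),
where ρ⁻² is about d/(2 ln k). The subtracted k - 1 becomes `o₁`, and the ln a in ρ becomes `o₂`.

Optimal error. Put t = ρ√d and let W count the agreements of z with the right string. The
log-likelihood of W is about (2W - d)ρ - t²/2, which at the mean of W is t²/2 = ln(ak) - (ln ln
k)/2. This lies below ln(δk) by an amount tending to infinity, so the likelihood exceeds δk only if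
W is above its mean by a margin, an event of probability about 1/2; a protocol gains at most δ more
(`Protocol.success_le`, `IsLarge.le_optErr`).

Conversely the nearest neighbor rule succeeds with probability at least 1/2, with no error term
(`half_le_success_nearestProtocol`). An O(1/t) defect would be of order 1/√(ln k), too large for
`o₁`. The threshold is placed slightly below the mean of W: this gains 0.455/t in probability, while
a union bound over the wrong strings loses at most 0.44/t. -/

instance isProbabilityMeasure_coin (p : ℝ) : IsProbabilityMeasure (coin p) := by
  unfold coin; infer_instance

instance isProbabilityMeasure_bsc {d : ℕ} (p : ℝ) (x : Cube d) :
    IsProbabilityMeasure (bsc p x) := by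
  have := fun i => Measure.isProbabilityMeasure_map (μ := coin p)
    (Measurable.of_discrete (f := fun b => xor (x i) b)).aemeasurable
  unfold bsc; infer_instance

instance isProbabilityMeasure_qHC (d : ℕ) (ρ : ℝ) : IsProbabilityMeasure (qHC d ρ) := by
  unfold qHC; infer_instance

instance isProbabilityMeasure_sampleHC {d : ℕ} (C : Cluster d) :
    IsProbabilityMeasure (sampleHC C) := by
  have (i : Fin d) : IsProbabilityMeasure
      (if (C i).1 then Measure.dirac (C i).2 else coin (1 / 2)) := by
    split_ifs <;> infer_instance
  unfold sampleHC; infer_instance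

/-! ### Point masses and the equality of the two tasks -/

lemma coin_singleton {p : ℝ} (h0 : 0 ≤ p) (h1 : p ≤ 1) (b : Bool) :
    coin p {b} = ENNReal.ofReal (if b then p else 1 - p) := by
  have hp : Set.projIcc 0 1 zero_le_one p = (⟨p, h0, h1⟩ : unitInterval) :=
    Set.projIcc_of_mem _ ⟨h0, h1⟩
  rw [coin, hp, bernoulliMeasure_apply _ (measurableSet_singleton b)]
  cases b
  · simp [ENNReal.ofReal, unitInterval.toNNReal]
    exact congrArg ENNReal.ofNNReal (Real.toNNReal_of_nonneg (sub_nonneg.2 h1)).symm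
  · simp [ENNReal.ofReal, unitInterval.toNNReal]
    exact congrArg ENNReal.ofNNReal (Real.toNNReal_of_nonneg h0).symm

lemma coin_half_singleton (b : Bool) : coin (1 / 2) {b} = ENNReal.ofReal (1 / 2) := by
  rw [coin_singleton (by norm_num) (by norm_num)]
  cases b <;> norm_num

/-- Transition probability of one bit through the binary symmetric channel. -/
def bitNoise (ρ : ℝ) (b c : Bool) : ℝ := if b = c then (1 + ρ) / 2 else (1 - ρ) / 2

/-- Transition probabilities of the binary symmetric channel with parameter `(1 - ρ) / 2`. -/
def noise {d : ℕ} (ρ : ℝ) (x z : Cube d) : ℝ := ∏ i, bitNoise ρ (x i) (z i)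

lemma bitNoise_nonneg {ρ : ℝ} (h0 : 0 ≤ ρ) (h1 : ρ ≤ 1) (b c : Bool) : 0 ≤ bitNoise ρ b c := by
  unfold bitNoise; split_ifs <;> linarith

lemma noise_nonneg {d : ℕ} {ρ : ℝ} (h0 : 0 ≤ ρ) (h1 : ρ ≤ 1) (x z : Cube d) : 0 ≤ noise ρ x z :=
  Finset.prod_nonneg fun _ _ => bitNoise_nonneg h0 h1 _ _

lemma sum_bitNoise (ρ : ℝ) (b : Bool) : ∑ c, bitNoise ρ b c = 1 := by
  cases b <;> simp [bitNoise] <;> ring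

lemma sum_noise {d : ℕ} (ρ : ℝ) (x : Cube d) : ∑ z, noise ρ x z = 1 := by
  unfold noise
  rw [← Fintype.piFinset_univ, ← Finset.prod_univ_sum]
  exact Finset.prod_eq_one fun i _ => sum_bitNoise ρ (x i)

lemma bsc_singleton {d : ℕ} {ρ : ℝ} (h0 : 0 ≤ ρ) (h1 : ρ ≤ 1) (x z : Cube d) :
    bsc ((1 - ρ) / 2) x {z} = ENNReal.ofReal (noise ρ x z) := by
  have := fun i => Measure.isProbabilityMeasure_map (μ := coin ((1 - ρ) / 2))
    (Measurable.of_discrete (f := fun b => xor (x i) b)).aemeasurable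
  rw [bsc, Measure.pi_singleton, noise,
    ENNReal.ofReal_prod_of_nonneg fun _ _ => bitNoise_nonneg h0 h1 _ _]
  refine Finset.prod_congr rfl fun i _ => ?_
  rw [Measure.map_apply .of_discrete (measurableSet_singleton _)]
  have : (fun b => xor (x i) b) ⁻¹' {z i} = {xor (x i) (z i)} := by
    ext b; cases b <;> cases x i <;> cases z i <;> simp
  rw [this, coin_singleton (by linarith) (by linarith)]
  congr 1
  unfold bitNoise
  cases x i <;> cases z i <;> simp <;> ring

lemma bind_singleton {α β : Type*} [MeasurableSpace α] [MeasurableSpace β] [Fintype α]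
    [DiscreteMeasurableSpace α] [MeasurableSingletonClass β] (μ : Measure α) (κ : α → Measure β)
    (b : β) : (μ.bind κ) {b} = ∑ a, μ {a} * κ a {b} := by
  rw [Measure.bind_apply (measurableSet_singleton b) (Measurable.of_discrete).aemeasurable,
    lintegral_fintype]
  simp_rw [mul_comm]

lemma uniformOn_univ_singleton {α : Type*} [MeasurableSpace α] [MeasurableSingletonClass α]
    [Fintype α] (a : α) : uniformOn (Set.univ : Set α) {a} = (Fintype.card α : ℝ≥0∞)⁻¹ := by
  rw [uniformOn_univ, Measure.count_singleton, one_div]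

lemma map_triple_singleton {α β γ : Type*} [MeasurableSpace α] [MeasurableSpace β]
    [MeasurableSpace γ] [DecidableEq α] [DecidableEq β]
    [MeasurableSingletonClass α] [MeasurableSingletonClass β]
    [MeasurableSingletonClass γ] [DiscreteMeasurableSpace γ]
    (ν : Measure γ) (a a' : α) (b b' : β) (c : γ) :
    (ν.map fun z => (a, b, z)) {(a', b', c)} = if a = a' ∧ b = b' then ν {c} else 0 := by
  rw [Measure.map_apply (Measurable.of_discrete) (measurableSet_singleton _)]
  split_ifs with h
  · obtain ⟨rfl, rfl⟩ := h
    congr 1; ext; simp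
  · convert! measure_empty (μ := ν)
    ext z; simp; tauto

lemma nearestNeighbors_singleton {k d : ℕ} {ρ : ℝ} (h0 : 0 ≤ ρ) (h1 : ρ ≤ 1)
    (X : Fin k → Cube d) (j : Fin k) (z : Cube d) :
    nearestNeighbors k d ρ {(X, j, z)} =
      (∏ _l : Fin k, (Fintype.card (Cube d) : ℝ≥0∞)⁻¹) * (k : ℝ≥0∞)⁻¹ *
        ENNReal.ofReal (noise ρ (X j) z) := by
  classical
  rw [nearestNeighbors, bind_singleton]
  simp_rw [bind_singleton, map_triple_singleton, Measure.pi_singleton, uniformOn_univ_singleton]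
  rw [Finset.sum_eq_single X, Finset.sum_eq_single j]
  · simp [bsc_singleton h0 h1, mul_assoc]
  · intro b _ hb; simp [hb]
  · simp
  · intro b _ hb; simp [hb]
  · simp

lemma sum_cluster_bit {ρ : ℝ} (h0 : 0 ≤ ρ) (h1 : ρ ≤ 1) (x : Bool) :
    ∑ c : Bool × Bool, ((coin ρ).prod (coin (1 / 2))) {c} *
      (if c.1 then Measure.dirac c.2 else coin (1 / 2)) {x} = 2⁻¹ := by
  have h2 : (2 : ℝ≥0∞)⁻¹ = ENNReal.ofReal (1 / 2) := by
    rw [one_div, ENNReal.ofReal_inv_of_pos (by norm_num)]; norm_num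
  have e (a b : Bool) : ({(a, b)} : Set (Bool × Bool)) = {a} ×ˢ {b} := by simp
  rw [Fintype.sum_prod_type]
  simp only [Fintype.sum_bool, e, Measure.prod_prod, coin_half_singleton, coin_singleton h0 h1, h2]
  cases x <;>
  · simp only [if_true, Measure.dirac_apply, Set.indicator, Bool.false_eq_true, if_false,
      Set.mem_singleton_iff, coin_half_singleton, Pi.one_apply, mul_one, mul_zero, add_zero,
      zero_add, Bool.true_eq_false]
    rw [← ENNReal.ofReal_mul h0, ← ENNReal.ofReal_mul (by linarith),
      ← ENNReal.ofReal_mul (by linarith), ← ENNReal.ofReal_add, ← ENNReal.ofReal_add]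
    · congr 1; ring
    all_goals nlinarith

/-- A fixed index contributes ρ/2 when the bits agree and 0 otherwise; a free one contributes (1 -
ρ)/4 in either case. -/
lemma sum_cluster_bit_bit {ρ : ℝ} (h0 : 0 ≤ ρ) (h1 : ρ ≤ 1) (x z : Bool) :
    ∑ c : Bool × Bool, ((coin ρ).prod (coin (1 / 2))) {c} *
      (if c.1 then Measure.dirac c.2 else coin (1 / 2)) {x} *
      (if c.1 then Measure.dirac c.2 else coin (1 / 2)) {z} =
        2⁻¹ * ENNReal.ofReal (bitNoise ρ x z) := by
  have h2 : (2 : ℝ≥0∞)⁻¹ = ENNReal.ofReal (1 / 2) := by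
    rw [one_div, ENNReal.ofReal_inv_of_pos (by norm_num)]; norm_num
  have e (a b : Bool) : ({(a, b)} : Set (Bool × Bool)) = {a} ×ˢ {b} := by simp
  rw [Fintype.sum_prod_type, h2, ← ENNReal.ofReal_mul (by norm_num)]
  simp only [Fintype.sum_bool, e, Measure.prod_prod, coin_half_singleton, coin_singleton h0 h1]
  cases x <;> cases z <;>
  · simp only [if_true, Measure.dirac_apply, Set.indicator, Bool.false_eq_true, if_false,
      Set.mem_singleton_iff, coin_half_singleton, Pi.one_apply, mul_one, mul_zero, add_zero,
      zero_add, Bool.true_eq_false, bitNoise]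
    try rw [← ENNReal.ofReal_mul h0]
    rw [← ENNReal.ofReal_mul (by linarith),
      ← ENNReal.ofReal_mul (by nlinarith), ← ENNReal.ofReal_mul (by nlinarith)]
    repeat rw [← ENNReal.ofReal_add (by nlinarith) (by nlinarith)]
    congr 1; ring

lemma sum_qHC_mul_prod {d : ℕ} {ρ : ℝ} (f : Fin d → Bool × Bool → ℝ≥0∞) :
    ∑ C, qHC d ρ {C} * ∏ i, f i (C i) =
      ∏ i, ∑ c : Bool × Bool, ((coin ρ).prod (coin (1 / 2))) {c} * f i c := by
  rw [Finset.prod_univ_sum, Fintype.piFinset_univ]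
  simp_rw [qHC, Measure.pi_singleton, Finset.prod_mul_distrib]

lemma sampleHC_singleton {d : ℕ} (C : Cluster d) (x : Cube d) :
    sampleHC C {x} = ∏ i, (if (C i).1 then Measure.dirac (C i).2 else coin (1 / 2)) {x i} := by
  have (i : Fin d) : IsProbabilityMeasure
      (if (C i).1 then Measure.dirac (C i).2 else coin (1 / 2)) := by
    split_ifs <;> infer_instance
  rw [sampleHC, Measure.pi_singleton]

lemma card_cube_inv (d : ℕ) : (Fintype.card (Cube d) : ℝ≥0∞)⁻¹ = ∏ _i : Fin d, 2⁻¹ := by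
  simp [ENNReal.inv_pow]

lemma sum_cluster {d : ℕ} {ρ : ℝ} (h0 : 0 ≤ ρ) (h1 : ρ ≤ 1) (x : Cube d) :
    ∑ C, qHC d ρ {C} * sampleHC C {x} = (Fintype.card (Cube d) : ℝ≥0∞)⁻¹ := by
  simp_rw [sampleHC_singleton, card_cube_inv]
  rw [sum_qHC_mul_prod fun i c => (if c.1 then Measure.dirac c.2 else coin (1 / 2)) {x i}]
  exact Finset.prod_congr rfl fun i _ => sum_cluster_bit h0 h1 _

lemma sum_cluster_cluster {d : ℕ} {ρ : ℝ} (h0 : 0 ≤ ρ) (h1 : ρ ≤ 1) (x z : Cube d) :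
    ∑ C, qHC d ρ {C} * (sampleHC C {x} * sampleHC C {z}) =
      (Fintype.card (Cube d) : ℝ≥0∞)⁻¹ * ENNReal.ofReal (noise ρ x z) := by
  simp_rw [sampleHC_singleton, card_cube_inv, ← Finset.prod_mul_distrib]
  rw [sum_qHC_mul_prod fun i c => (if c.1 then Measure.dirac c.2 else coin (1 / 2)) {x i} *
    (if c.1 then Measure.dirac c.2 else coin (1 / 2)) {z i}, noise,
    ENNReal.ofReal_prod_of_nonneg fun _ _ => bitNoise_nonneg h0 h1 _ _, ← Finset.prod_mul_distrib]
  refine Finset.prod_congr rfl fun i _ => ?_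
  rw [← sum_cluster_bit_bit h0 h1]
  simp_rw [mul_assoc]

lemma singletonsHC_singleton {k d : ℕ} {ρ : ℝ} (h0 : 0 ≤ ρ) (h1 : ρ ≤ 1)
    (X : Fin k → Cube d) (j : Fin k) (z : Cube d) :
    singletonsHC k d ρ {(X, j, z)} =
      (∏ _l : Fin k, (Fintype.card (Cube d) : ℝ≥0∞)⁻¹) * (k : ℝ≥0∞)⁻¹ *
        ENNReal.ofReal (noise ρ (X j) z) := by
  classical
  have hC (C : Fin k → Cluster d) :
      ((Measure.pi fun j => sampleHC (C j)).bind fun X =>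
        (uniformOn (Set.univ : Set (Fin k))).bind fun j =>
          (sampleHC (C j)).map fun z => (X, j, z)) {(X, j, z)} =
      (∏ l, sampleHC (C l) {X l} * if l = j then sampleHC (C l) {z} else 1) * (k : ℝ≥0∞)⁻¹ := by
    rw [bind_singleton]
    simp_rw [bind_singleton, map_triple_singleton, Measure.pi_singleton, uniformOn_univ_singleton]
    rw [Finset.sum_eq_single X, Finset.sum_eq_single j]
    · rw [Finset.prod_mul_distrib]
      simp [mul_assoc, mul_comm]
    · intro b _ hb; simp [hb]
    · simp
    · intro b _ hb; simp [hb]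
    · simp
  rw [singletonsHC, bind_singleton]
  simp_rw [hC, Measure.pi_singleton, ← mul_assoc]
  -- The clusters are independent, so the sum over all of them factors; only cluster j carries the
  -- additional factor of z.
  rw [← Finset.sum_mul]
  simp_rw [← Finset.prod_mul_distrib]
  rw [← Fintype.piFinset_univ, ← Finset.prod_univ_sum (fun _ => Finset.univ) fun l c =>
    qHC d ρ {c} * (sampleHC c {X l} * if l = j then sampleHC c {z} else 1)]
  have hl (l : Fin k) : ∑ c, qHC d ρ {c} * (sampleHC c {X l} * if l = j then sampleHC c {z} else 1)
      = (Fintype.card (Cube d) : ℝ≥0∞)⁻¹ *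
        if l = j then ENNReal.ofReal (noise ρ (X l) z) else 1 := by
    split_ifs with h
    · exact sum_cluster_cluster h0 h1 _ _
    · simpa using sum_cluster h0 h1 _
  simp_rw [hl]
  rw [Finset.prod_mul_distrib]
  simp only [Finset.prod_ite_eq', Finset.mem_univ, if_true]
  ring

/-- Both tasks are the same joint law. -/
theorem singletonsHC_eq_nearestNeighbors {k d : ℕ} {ρ : ℝ} (h0 : 0 ≤ ρ) (h1 : ρ ≤ 1) :
    singletonsHC k d ρ = nearestNeighbors k d ρ :=
  Measure.ext_of_singleton fun ⟨X, j, z⟩ => by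
    rw [singletonsHC_singleton h0 h1, nearestNeighbors_singleton h0 h1]

instance isProbabilityMeasure_nearestNeighbors {k d : ℕ} [NeZero k] (ρ : ℝ) :
    IsProbabilityMeasure (nearestNeighbors k d ρ) := by
  have := isProbabilityMeasure_uniformOn (s := (Set.univ : Set (Cube d))) Set.finite_univ
    Set.univ_nonempty
  have := isProbabilityMeasure_uniformOn (s := (Set.univ : Set (Fin k))) Set.finite_univ
    Set.univ_nonempty
  have (X : Fin k → Cube d) (j : Fin k) : IsProbabilityMeasure
      ((bsc ((1 - ρ) / 2) (X j)).map fun z => (X, j, z)) :=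
    Measure.isProbabilityMeasure_map (Measurable.of_discrete).aemeasurable
  have (X : Fin k → Cube d) : IsProbabilityMeasure ((uniformOn (Set.univ : Set (Fin k))).bind
      fun j => (bsc ((1 - ρ) / 2) (X j)).map fun z => (X, j, z)) :=
    isProbabilityMeasure_bind (Measurable.of_discrete).aemeasurable (ae_of_all _ fun _ => this _ _)
  exact isProbabilityMeasure_bind (Measurable.of_discrete).aemeasurable (ae_of_all _ this)

/-! ### Strong data processing for the binary symmetric channel -/

lemma mul_sinh_mul_cosh_le {ρ v : ℝ} (h0 : 0 ≤ ρ) (h1 : ρ ≤ 1) (hv : 0 ≤ v) :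
    ρ * Real.sinh v * Real.cosh (ρ * v) ≤ Real.sinh (ρ * v) * Real.cosh v := by
  let f : ℝ → ℝ := fun v =>
    Real.sinh (ρ * v) * Real.cosh v - ρ * Real.sinh v * Real.cosh (ρ * v)
  have hd (v : ℝ) : HasDerivAt f ((1 - ρ ^ 2) * (Real.sinh v * Real.sinh (ρ * v))) v := by
    have hm : HasDerivAt (fun v : ℝ => ρ * v) ρ v := by
      simpa using (hasDerivAt_id v).const_mul ρ
    have := (hm.sinh.mul (Real.hasDerivAt_cosh v)).sub
      (((Real.hasDerivAt_sinh v).const_mul ρ).mul hm.cosh)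
    convert! this using 1
    ring
  have hm : MonotoneOn f (Set.Ici 0) := by
    refine monotoneOn_of_deriv_nonneg (convex_Ici 0)
      (fun x _ => (hd x).continuousAt.continuousWithinAt)
      (fun x _ => (hd x).differentiableAt.differentiableWithinAt) fun x hx => ?_
    rw [interior_Ici, Set.mem_Ioi] at hx
    rw [(hd x).deriv]
    exact mul_nonneg (by nlinarith) (mul_nonneg (Real.sinh_nonneg_iff.2 hx.le)
      (Real.sinh_nonneg_iff.2 (by positivity)))
  have := hm (Set.mem_Ici.2 le_rfl) (Set.mem_Ici.2 hv) hv
  simp only [f, mul_zero, Real.sinh_zero, zero_mul, sub_self] at this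
  linarith

/-- Both sides vanish at 0 and are even, and `mul_sinh_mul_cosh_le` says that their difference is
monotone on v ≥ 0. The factor ρ² here is the contraction coefficient of the channel. -/
lemma sq_mul_log_cosh_le {ρ : ℝ} (h0 : 0 ≤ ρ) (h1 : ρ ≤ 1) (v : ℝ) :
    ρ ^ 2 * Real.log (Real.cosh v) ≤ Real.log (Real.cosh (ρ * v)) := by
  wlog hv : 0 ≤ v generalizing v
  · simpa using this (-v) (by linarith)
  let f : ℝ → ℝ := fun v => Real.log (Real.cosh (ρ * v)) - ρ ^ 2 * Real.log (Real.cosh v)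
  have hd (v : ℝ) : HasDerivAt f (Real.sinh (ρ * v) * ρ / Real.cosh (ρ * v) -
      ρ ^ 2 * (Real.sinh v / Real.cosh v)) v := by
    have hm : HasDerivAt (fun v : ℝ => ρ * v) ρ v := by
      simpa using (hasDerivAt_id v).const_mul ρ
    exact (hm.cosh.log (Real.cosh_pos _).ne').sub
      (((Real.hasDerivAt_cosh v).log (Real.cosh_pos _).ne').const_mul _)
  have hm : MonotoneOn f (Set.Ici 0) := by
    refine monotoneOn_of_deriv_nonneg (convex_Ici 0)
      (fun x _ => (hd x).continuousAt.continuousWithinAt)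
      (fun x _ => (hd x).differentiableAt.differentiableWithinAt) fun x hx => ?_
    rw [interior_Ici, Set.mem_Ioi] at hx
    have c1 := Real.cosh_pos x
    have c2 := Real.cosh_pos (ρ * x)
    have := mul_le_mul_of_nonneg_left (mul_sinh_mul_cosh_le h0 h1 hx.le) h0
    rw [(hd x).deriv, sub_nonneg, ← mul_div_assoc, div_le_div_iff₀ c1 c2]
    nlinarith
  have := hm (Set.mem_Ici.2 le_rfl) (Set.mem_Ici.2 hv) hv
  simp only [f, mul_zero, Real.cosh_zero, Real.log_one, sub_zero] at this
  linarith

lemma cosh_div_le_rpow {ρ : ℝ} (h0 : 0 < ρ) (h1 : ρ ≤ 1) (w : ℝ) :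
    Real.cosh (w / ρ) ≤ Real.cosh w ^ (1 / ρ ^ 2) := by
  have h := sq_mul_log_cosh_le h0.le h1 (w / ρ)
  rw [mul_div_cancel₀ _ h0.ne'] at h
  rw [← Real.log_le_log_iff (Real.cosh_pos _) (Real.rpow_pos_of_pos (Real.cosh_pos _) _),
    Real.log_rpow (Real.cosh_pos _), one_div, ← div_eq_inv_mul, le_div_iff₀ (by positivity)]
  linarith

/-- The one-bit case of `exp_noise_le`. -/
lemma exp_bitNoise_le {ρ : ℝ} (h0 : 0 < ρ) (h1 : ρ ≤ 1) (G : Bool → ℝ) :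
    (1 / 2) * ∑ b, Real.exp (1 / ρ ^ 2 * ∑ c, bitNoise ρ b c * G c) ≤
      ((1 / 2) * ∑ c, Real.exp (G c)) ^ (1 / ρ ^ 2) := by
  set r := 1 / ρ ^ 2
  set u := G true
  set v := G false
  have hr : r * ρ = 1 / ρ := by simp only [r]; field_simp
  -- Split G into its mean and its half-difference. The noise keeps the mean and multiplies the
  -- half-difference by ρ, so the exponent ρ⁻² turns the latter into division by ρ.
  have hR : (1 / 2) * ∑ c, Real.exp (G c) = Real.exp ((u + v) / 2) * Real.cosh ((u - v) / 2) := by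
    have e1 : Real.exp (G true) = Real.exp ((u + v) / 2) * Real.exp ((u - v) / 2) := by
      rw [← Real.exp_add]; congr 1; ring
    have e2 : Real.exp (G false) = Real.exp ((u + v) / 2) * Real.exp (-((u - v) / 2)) := by
      rw [← Real.exp_add]; congr 1; ring
    rw [Real.cosh_eq, Fintype.sum_bool, e1, e2]
    ring
  have hL : (1 / 2) * ∑ b, Real.exp (r * ∑ c, bitNoise ρ b c * G c) =
      Real.exp ((u + v) / 2 * r) * Real.cosh ((u - v) / 2 / ρ) := by
    have e1 : Real.exp (r * ∑ c, bitNoise ρ true c * G c) =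
        Real.exp ((u + v) / 2 * r) * Real.exp ((u - v) / 2 / ρ) := by
      rw [← Real.exp_add, div_eq_mul_one_div _ ρ, ← hr]
      congr 1
      simp only [Fintype.sum_bool, bitNoise, if_true, Bool.true_eq_false, if_false]
      ring
    have e2 : Real.exp (r * ∑ c, bitNoise ρ false c * G c) =
        Real.exp ((u + v) / 2 * r) * Real.exp (-((u - v) / 2 / ρ)) := by
      rw [← Real.exp_add, div_eq_mul_one_div _ ρ, ← hr]
      congr 1
      simp only [Fintype.sum_bool, bitNoise, if_true, Bool.false_eq_true, if_false]
      ring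
    rw [Real.cosh_eq, Fintype.sum_bool, e1, e2]
    ring
  rw [hL, hR, Real.mul_rpow (Real.exp_pos _).le (Real.cosh_pos _).le, ← Real.exp_mul]
  exact mul_le_mul_of_nonneg_left (cosh_div_le_rpow h0 h1 _) (Real.exp_pos _).le

/-- Convexity of the log-sum-exp function. -/
lemma sum_exp_sum_le {ι κ : Type*} [Fintype ι] [Fintype κ] [Nonempty ι] (C : ℝ) (hC : 0 < C)
    (w : κ → ℝ) (hw : ∀ c, 0 ≤ w c) (hw1 : ∑ c, w c = 1) (φ : κ → ι → ℝ) :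
    C * ∑ z, Real.exp (∑ c, w c * φ c z) ≤
      Real.exp (∑ c, w c * Real.log (C * ∑ z, Real.exp (φ c z))) := by
  set A : κ → ℝ := fun c => C * ∑ z, Real.exp (φ c z)
  have hA (c : κ) : 0 < A c :=
    mul_pos hC (Finset.sum_pos (fun _ _ => Real.exp_pos _) Finset.univ_nonempty)
  -- Dividing subtracts from each `φ c` its log-partition function; Jensen for exp then bounds the
  -- quotient by a weighted mean of sums normalized to 1.
  rw [← div_le_one (Real.exp_pos _)]
  calc C * (∑ z, Real.exp (∑ c, w c * φ c z)) / Real.exp (∑ c, w c * Real.log (A c))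
      = C * ∑ z, Real.exp (∑ c, w c • (φ c z - Real.log (A c))) := by
        rw [mul_div_assoc, Finset.sum_div]
        congr 1
        refine Finset.sum_congr rfl fun z _ => ?_
        rw [← Real.exp_sub, ← Finset.sum_sub_distrib]
        simp [mul_sub]
    _ ≤ C * ∑ z, ∑ c, w c • Real.exp (φ c z - Real.log (A c)) := by
        refine mul_le_mul_of_nonneg_left (Finset.sum_le_sum fun z _ => ?_) hC.le
        exact convexOn_exp.map_sum_le (fun c _ => hw c) hw1 fun _ _ => Set.mem_univ _
    _ = ∑ c, w c * (C * (∑ z, Real.exp (φ c z)) / A c) := by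
        rw [Finset.sum_comm, Finset.mul_sum]
        refine Finset.sum_congr rfl fun c _ => ?_
        simp_rw [Real.exp_sub, Real.exp_log (hA c), smul_eq_mul, ← Finset.mul_sum,
          ← Finset.sum_div]
        ring
    _ = 1 := by
        rw [← hw1]
        exact Finset.sum_congr rfl fun c _ => by rw [div_self (hA c).ne', mul_one]

lemma sum_cube_succ {n : ℕ} (f : Cube (n + 1) → ℝ) :
    ∑ x, f x = ∑ b, ∑ x : Cube n, f (Fin.cons b x) := by
  rw [← Fintype.sum_prod_type']
  exact (Fintype.sum_equiv (Fin.consEquiv fun _ => Bool) _ _ fun _ => rfl).symm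

lemma noise_cons {n : ℕ} (ρ : ℝ) (b c : Bool) (x z : Cube n) :
    noise ρ (Fin.cons b x : Cube (n + 1)) (Fin.cons c z) = bitNoise ρ b c * noise ρ x z := by
  simp [noise, Fin.prod_univ_succ]

/-- The strong data processing inequality of the binary symmetric channel for uniform inputs, in
dual form. -/
theorem exp_noise_le {ρ : ℝ} (h0 : 0 < ρ) (h1 : ρ ≤ 1) {d : ℕ} (φ : Cube d → ℝ) :
    (1 / 2) ^ d * ∑ x, Real.exp (1 / ρ ^ 2 * ∑ z, noise ρ x z * φ z) ≤
      ((1 / 2) ^ d * ∑ z, Real.exp (φ z)) ^ (1 / ρ ^ 2) := by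
  induction d with
  | zero =>
    simp only [Fintype.sum_unique, pow_zero, one_mul, noise, Finset.univ_eq_empty,
      Finset.prod_empty]
    rw [← Real.exp_mul, mul_comm]
  | succ n ih =>
    have hr : 0 ≤ 1 / ρ ^ 2 := by positivity
    set r := 1 / ρ ^ 2
    -- Tensorization: the induction hypothesis is applied to φ averaged over the first output bit,
    -- `sum_exp_sum_le` pulls this average out of the log-partition function, and the one-bit case
    -- is applied to `G`.
    set G : Bool → ℝ := fun c => Real.log ((1 / 2) ^ n * ∑ z : Cube n, Real.exp (φ (Fin.cons c z)))
    have hG (c : Bool) : Real.exp (G c) = (1 / 2) ^ n * ∑ z : Cube n, Real.exp (φ (Fin.cons c z)) :=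
      Real.exp_log (mul_pos (by positivity)
        (Finset.sum_pos (fun _ _ => Real.exp_pos _) Finset.univ_nonempty))
    calc (1 / 2) ^ (n + 1) * ∑ x : Cube (n + 1), Real.exp (r * ∑ z, noise ρ x z * φ z)
        = (1 / 2) * ∑ b, ((1 / 2) ^ n * ∑ x : Cube n, Real.exp (r * ∑ z : Cube n, noise ρ x z *
            ∑ c, bitNoise ρ b c * φ (Fin.cons c z))) := by
          rw [sum_cube_succ, pow_succ', mul_assoc, Finset.mul_sum]
          congr 1
          refine Finset.sum_congr rfl fun b _ => ?_
          congr 1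
          refine Finset.sum_congr rfl fun x _ => ?_
          rw [sum_cube_succ, Finset.sum_comm]
          simp_rw [noise_cons, Finset.mul_sum]
          congr 1
          refine Finset.sum_congr rfl fun z _ => Finset.sum_congr rfl fun c _ => by ring
      _ ≤ (1 / 2) * ∑ b, ((1 / 2) ^ n * ∑ z : Cube n,
            Real.exp (∑ c, bitNoise ρ b c * φ (Fin.cons c z))) ^ r := by
          gcongr with b
          exact ih fun z => ∑ c, bitNoise ρ b c * φ (Fin.cons c z)
      _ ≤ (1 / 2) * ∑ b, Real.exp (r * ∑ c, bitNoise ρ b c * G c) := by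
          gcongr with b
          rw [mul_comm r, Real.exp_mul]
          exact Real.rpow_le_rpow (by positivity) (sum_exp_sum_le _ (by positivity) _
            (bitNoise_nonneg h0.le h1 b) (sum_bitNoise ρ b) _) hr
      _ ≤ ((1 / 2) * ∑ c, Real.exp (G c)) ^ r := exp_bitNoise_le h0 h1 G
      _ = _ := by
          simp_rw [hG]
          rw [sum_cube_succ, ← Finset.mul_sum, pow_succ', mul_assoc]

/-! ### The information lower bound -/

/-- The Donsker-Varadhan lower bound for the Kullback-Leibler divergence. -/
theorem ofReal_le_klDiv {α : Type*} [MeasurableSpace α] (μ ν : Measure α) [IsProbabilityMeasure μ]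
    [IsProbabilityMeasure ν] {f : α → ℝ} (hf : Integrable f μ)
    (he : Integrable (fun x => Real.exp (f x)) ν) :
    ENNReal.ofReal (∫ x, f x ∂μ - Real.log (∫ x, Real.exp (f x) ∂ν)) ≤
      InformationTheory.klDiv μ ν := by
  by_cases h : InformationTheory.klDiv μ ν = ∞
  · rw [h]; exact le_top
  obtain ⟨hac, hint⟩ := InformationTheory.klDiv_ne_top_iff.1 h
  -- The inequality is nonnegativity of the divergence of μ from ν tilted by f, expanded.
  have := isProbabilityMeasure_tilted he
  have hac' : μ ≪ ν.tilted f := hac.trans (absolutelyContinuous_tilted he)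
  have h1 := InformationTheory.integral_llr_add_sub_measure_univ_nonneg hac'
    (integrable_llr_tilted_right hac hf hint he)
  rw [integral_llr_tilted_right hac hf he hint] at h1
  refine ENNReal.ofReal_le_of_le_toReal ?_
  rw [InformationTheory.toReal_klDiv_of_measure_eq hac (by simp)]
  simp only [probReal_univ] at h1
  linarith

variable {k d : ℕ}

lemma real_nearestNeighbors_singleton {ρ : ℝ} (h0 : 0 ≤ ρ) (h1 : ρ ≤ 1)
    (X : Fin k → Cube d) (j : Fin k) (z : Cube d) :
    (nearestNeighbors k d ρ).real {(X, j, z)} =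
      ((1 / 2) ^ d) ^ k * (k : ℝ)⁻¹ * noise ρ (X j) z := by
  rw [measureReal_def, nearestNeighbors_singleton h0 h1]
  simp [ENNReal.toReal_ofReal (noise_nonneg h0 h1 _ _)]

lemma fst_nearestNeighbors [NeZero k] {ρ : ℝ} (h0 : 0 ≤ ρ) (h1 : ρ ≤ 1) :
    (nearestNeighbors k d ρ).fst =
      Measure.pi fun _ : Fin k => uniformOn (Set.univ : Set (Cube d)) := by
  classical
  refine Measure.ext_of_singleton fun X => ?_
  rw [Measure.fst_apply (measurableSet_singleton X),
    ← lintegral_indicator_one (measurable_fst (measurableSet_singleton X)), lintegral_fintype,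
    Fintype.sum_prod_type, Finset.sum_eq_single X]
  · rw [Fintype.sum_prod_type]
    simp only [nearestNeighbors_singleton h0 h1, ← Finset.mul_sum, Set.indicator,
      Set.mem_preimage, Set.mem_singleton_iff, if_true, Pi.one_apply, one_mul,
      ← ENNReal.ofReal_sum_of_nonneg fun z _ => noise_nonneg h0 h1 _ z, sum_noise,
      Measure.pi_singleton, uniformOn_univ_singleton]
    simp only [ENNReal.ofReal_one, mul_one, Finset.prod_const, Finset.card_univ, Fintype.card_fin,
      Finset.sum_const, nsmul_eq_mul]
    rw [mul_assoc, ENNReal.inv_mul_cancel (by simp [NeZero.ne k]) (by simp),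
      mul_one]
  · intro X' _ h
    simp [h]
  · simp

namespace Protocol

/-- The probability that Bob outputs `j` on examples `X` and test string `z`. -/
def guess (P : Protocol k d) (X : Fin k → Cube d) (z : Cube d) (j : Fin k) : ℝ :=
  ∫ m, (P.bob (m, z)).real {j} ∂P.alice X

/-- The success probability on Nearest of `k` Neighbors. -/
def success (P : Protocol k d) (ρ : ℝ) : ℝ :=
  ∑ X : Fin k → Cube d, ∑ j, ∑ z, ((1 / 2) ^ d) ^ k * (k : ℝ)⁻¹ * noise ρ (X j) z * P.guess X z j

variable (P : Protocol k d)

lemma measurable_bob_real (z : Cube d) (j : Fin k) :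
    Measurable fun m => (P.bob (m, z)).real {j} :=
  ((P.bob.measurable_coe (measurableSet_singleton j)).comp
    (measurable_id.prodMk measurable_const)).ennreal_toReal

lemma integrable_bob_real (X : Fin k → Cube d) (z : Cube d) (j : Fin k) :
    Integrable (fun m => (P.bob (m, z)).real {j}) (P.alice X) :=
  Integrable.of_bound (P.measurable_bob_real z j).aestronglyMeasurable 1
    (ae_of_all _ fun m => by
      rw [Real.norm_of_nonneg measureReal_nonneg]; exact measureReal_le_one)

lemma sum_bob_real (m : P.Msg) (z : Cube d) : ∑ j, (P.bob (m, z)).real {j} = 1 := by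
  simp [sum_measureReal_singleton]

lemma guess_nonneg (X : Fin k → Cube d) (z : Cube d) (j : Fin k) : 0 ≤ P.guess X z j :=
  integral_nonneg fun _ => measureReal_nonneg

lemma sum_guess (X : Fin k → Cube d) (z : Cube d) : ∑ j, P.guess X z j = 1 := by
  simp_rw [guess]
  rw [← integral_finsetSum _ fun j _ => P.integrable_bob_real X z j]
  simp [P.sum_bob_real]

lemma err_nearestNeighbors [NeZero k] {ρ : ℝ} (h0 : 0 ≤ ρ) (h1 : ρ ≤ 1) :
    P.err (nearestNeighbors k d ρ) = 1 - P.success ρ := by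
  have hin (ω : (Fin k → Cube d) × Fin k × Cube d) :
      ∫⁻ m, P.bob (m, ω.2.2) {ω.2.1}ᶜ ∂(P.alice ω.1) =
        ENNReal.ofReal (1 - P.guess ω.1 ω.2.2 ω.2.1) := by
    have hi := P.integrable_bob_real ω.1 ω.2.2 ω.2.1
    have : 1 - P.guess ω.1 ω.2.2 ω.2.1 =
        ∫ m, (1 - (P.bob (m, ω.2.2)).real {ω.2.1}) ∂P.alice ω.1 := by
      rw [integral_sub (integrable_const _) hi]; simp [guess]
    have hi' : Integrable (fun m => 1 - (P.bob (m, ω.2.2)).real {ω.2.1}) (P.alice ω.1) :=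
      (integrable_const _).sub hi
    rw [this, ofReal_integral_eq_lintegral_ofReal hi'
      (ae_of_all _ fun m => sub_nonneg.2 measureReal_le_one)]
    refine lintegral_congr fun m => ?_
    rw [← probReal_compl_eq_one_sub (measurableSet_singleton _), ofReal_measureReal]
  have hg (ω : (Fin k → Cube d) × Fin k × Cube d) : 0 ≤ 1 - P.guess ω.1 ω.2.2 ω.2.1 := by
    rw [sub_nonneg, ← P.sum_guess ω.1 ω.2.2]
    exact Finset.single_le_sum (fun j _ => P.guess_nonneg _ _ j) (Finset.mem_univ _)
  rw [err]
  simp_rw [hin]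
  rw [← ofReal_integral_eq_lintegral_ofReal .of_finite (ae_of_all _ hg),
    ENNReal.toReal_ofReal (integral_nonneg hg), integral_sub .of_finite .of_finite]
  congr 1
  · simp
  · rw [integral_fintype .of_finite, Fintype.sum_prod_type]
    simp_rw [Fintype.sum_prod_type, real_nearestNeighbors_singleton h0 h1, smul_eq_mul]
    rfl

/-- The test function used to bound the information from below. -/
def potential (ρ : ℝ) (p : (Fin k → Cube d) × P.Msg) : ℝ :=
  ∑ j, 1 / ρ ^ 2 * ∑ z, noise ρ (p.1 j) z * (Real.log k * (P.bob (p.2, z)).real {j})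

lemma measurable_potential (ρ : ℝ) : Measurable (P.potential ρ) := by
  refine measurable_from_prod_countable_right fun X => ?_
  have h := P.measurable_bob_real
  simp only [potential]
  fun_prop

lemma abs_potential_le {ρ : ℝ} (h0 : 0 ≤ ρ) (h1 : ρ ≤ 1)
    (p : (Fin k → Cube d) × P.Msg) :
    |P.potential ρ p| ≤ ∑ _j : Fin k, 1 / ρ ^ 2 * Real.log k := by
  have hl : 0 ≤ Real.log k := Real.log_natCast_nonneg k
  rw [potential, abs_of_nonneg]
  · gcongr with j
    calc ∑ z, noise ρ (p.1 j) z * (Real.log k * (P.bob (p.2, z)).real {j})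
        ≤ ∑ z, noise ρ (p.1 j) z * Real.log k := by
          gcongr with z
          · exact noise_nonneg h0 h1 _ _
          · exact mul_le_of_le_one_right hl measureReal_le_one
      _ = Real.log k := by rw [← Finset.sum_mul, sum_noise, one_mul]
  · exact Finset.sum_nonneg fun j _ => mul_nonneg (by positivity) (Finset.sum_nonneg fun z _ =>
      mul_nonneg (noise_nonneg h0 h1 _ _) (mul_nonneg hl measureReal_nonneg))

lemma integral_uniform (f : Cube d → ℝ) :
    ∫ x, f x ∂uniformOn (Set.univ : Set (Cube d)) = (1 / 2) ^ d * ∑ x, f x := by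
  have := isProbabilityMeasure_uniformOn (s := (Set.univ : Set (Cube d))) Set.finite_univ
    Set.univ_nonempty
  rw [integral_fintype .of_finite, Finset.mul_sum]
  refine Finset.sum_congr rfl fun x _ => ?_
  rw [measureReal_def, uniformOn_univ_singleton]
  simp

/-- The function k^b lies below its chord on [0, 1]. A bound linear in b is needed because Bob's
probabilities are later summed over j. -/
lemma exp_log_mul_le [NeZero k] {b : ℝ} (h0 : 0 ≤ b) (h1 : b ≤ 1) :
    Real.exp (Real.log k * b) ≤ 1 + (k - 1) * b := by
  have hk : (1 : ℝ) ≤ k := by exact_mod_cast NeZero.one_le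
  rw [← Real.rpow_def_of_pos (by linarith)]
  have := rpow_one_add_le_one_add_mul_self (s := (k : ℝ) - 1) (by linarith) h0 h1
  rw [add_sub_cancel] at this
  linarith

/-- For a fixed message the potential is a sum of functions of the separate, independent examples,
so the integral is a product to which `exp_noise_le` applies factor by factor. -/
lemma integral_exp_potential_le [NeZero k] {ρ : ℝ} (h0 : 0 < ρ) (h1 : ρ ≤ 1) (m : P.Msg) :
    ∫ X, Real.exp (P.potential ρ (X, m))
        ∂(Measure.pi fun _ : Fin k => uniformOn (Set.univ : Set (Cube d))) ≤
      Real.exp ((k - 1) * (1 / ρ ^ 2)) := by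
  have := isProbabilityMeasure_uniformOn (s := (Set.univ : Set (Cube d))) Set.finite_univ
    Set.univ_nonempty
  have hk : (1 : ℝ) ≤ k := by exact_mod_cast NeZero.one_le
  simp_rw [potential, Real.exp_sum]
  rw [integral_fintype_prod_eq_prod (𝕜 := ℝ) fun (j : Fin k) (x : Cube d) =>
    Real.exp (1 / ρ ^ 2 * ∑ z, noise ρ x z * (Real.log k * (P.bob (m, z)).real {j}))]
  simp_rw [integral_uniform]
  calc _ ≤ ∏ j : Fin k, Real.exp ((k - 1) * ((1 / 2) ^ d * ∑ z, (P.bob (m, z)).real {j})) ^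
        (1 / ρ ^ 2) := by
        refine Finset.prod_le_prod (fun j _ => by positivity) fun j _ => ?_
        refine (exp_noise_le h0 h1 _).trans (Real.rpow_le_rpow (by positivity) ?_ (by positivity))
        calc (1 / 2) ^ d * ∑ z : Cube d, Real.exp (Real.log k * (P.bob (m, z)).real {j})
            ≤ (1 / 2) ^ d * ∑ z : Cube d, (1 + (k - 1) * (P.bob (m, z)).real {j}) := by
              gcongr with z
              exact exp_log_mul_le measureReal_nonneg measureReal_le_one
          _ = (k - 1) * ((1 / 2) ^ d * ∑ z, (P.bob (m, z)).real {j}) + 1 := by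
              rw [Finset.sum_add_distrib, ← Finset.mul_sum]
              simp [mul_add]
              ring
          _ ≤ _ := Real.add_one_le_exp _
    _ = _ := by
        rw [Real.finsetProd_rpow _ _ fun _ _ => (Real.exp_pos _).le, ← Real.exp_sum,
          ← Finset.mul_sum, ← Finset.mul_sum, Finset.sum_comm, ← Real.exp_mul]
        simp [P.sum_bob_real]

/-- The information lower bound in terms of the success probability, in nats. -/
theorem le_klDiv_of_success [NeZero k] {ρ : ℝ} (h0 : 0 < ρ) (h1 : ρ ≤ 1) :
    ENNReal.ofReal (1 / ρ ^ 2 * (k * P.success ρ * Real.log k - (k - 1))) ≤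
      InformationTheory.klDiv ((nearestNeighbors k d ρ).fst ⊗ₘ P.alice)
        ((nearestNeighbors k d ρ).fst.prod (P.alice ∘ₘ (nearestNeighbors k d ρ).fst)) := by
  have hu := isProbabilityMeasure_uniformOn (s := (Set.univ : Set (Cube d))) Set.finite_univ
    Set.univ_nonempty
  have hk : (k : ℝ) ≠ 0 := by exact_mod_cast NeZero.ne k
  rw [fst_nearestNeighbors h0.le h1]
  set U := Measure.pi fun _ : Fin k => uniformOn (Set.univ : Set (Cube d))
  have hf : Integrable (P.potential ρ) (U ⊗ₘ P.alice) :=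
    Integrable.of_bound (P.measurable_potential ρ).aestronglyMeasurable _
      (ae_of_all _ fun p => P.abs_potential_le h0.le h1 p)
  have he : Integrable (fun p => Real.exp (P.potential ρ p)) (U.prod (P.alice ∘ₘ U)) :=
    Integrable.of_bound (P.measurable_potential ρ).exp.aestronglyMeasurable
      (Real.exp (∑ _j : Fin k, 1 / ρ ^ 2 * Real.log k)) (ae_of_all _ fun p => by
        rw [Real.norm_of_nonneg (Real.exp_pos _).le]
        exact Real.exp_le_exp.2 ((le_abs_self _).trans (P.abs_potential_le h0.le h1 p)))
  refine le_trans (ENNReal.ofReal_le_ofReal ?_) (ofReal_le_klDiv _ _ hf he)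
  have hE : ∫ p, P.potential ρ p ∂(U ⊗ₘ P.alice) = 1 / ρ ^ 2 * (k * P.success ρ * Real.log k) := by
    have hX (X : Fin k → Cube d) : U.real {X} = ((1 / 2) ^ d) ^ k := by
      rw [measureReal_def, Measure.pi_singleton]
      simp_rw [uniformOn_univ_singleton]
      simp
    rw [Measure.integral_compProd hf, integral_fintype .of_finite, success, Finset.mul_sum,
      Finset.sum_mul, Finset.mul_sum]
    refine Finset.sum_congr rfl fun X _ => ?_
    rw [hX]
    simp only [potential]
    have hi (j : Fin k) (z : Cube d) : Integrable (fun m => noise ρ (X j) z *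
        (Real.log k * (P.bob (m, z)).real {j})) (P.alice X) :=
      ((P.integrable_bob_real X z j).const_mul _).const_mul _
    rw [integral_finsetSum _ fun j _ => (integrable_finsetSum _ fun z _ => hi j z).const_mul _]
    simp_rw [integral_const_mul, integral_finsetSum _ fun z _ => hi _ z, integral_const_mul,
      smul_eq_mul, Finset.mul_sum, Finset.sum_mul, Finset.mul_sum]
    refine Finset.sum_congr rfl fun j _ => Finset.sum_congr rfl fun z _ => ?_
    rw [guess]
    field_simp
  -- Under the product law the examples can be integrated out first, with the message held fixed.
  have hL : Real.log (∫ p, Real.exp (P.potential ρ p) ∂(U.prod (P.alice ∘ₘ U))) ≤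
      (k - 1) * (1 / ρ ^ 2) := by
    rw [Real.log_le_iff_le_exp (integral_exp_pos he), integral_prod_symm _ he]
    calc _ ≤ ∫ _m, Real.exp ((k - 1) * (1 / ρ ^ 2)) ∂(P.alice ∘ₘ U) :=
          integral_mono he.integral_prod_right (integrable_const _)
            fun m => P.integral_exp_potential_le h0 h1 m
      _ = _ := by simp
  rw [hE]
  linarith

end Protocol

/-! ### Agreement counts and the upper bound for the success of any protocol -/

/-- The number of positions at which two strings agree. -/
def agree (x z : Cube d) : ℕ := (Finset.univ.filter fun i => x i = z i).card

/-- The likelihood ratio of `w` agreements among `d` bits, relative to the uniform distribution. -/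
def lik (ρ : ℝ) (d w : ℕ) : ℝ := (1 + ρ) ^ w * (1 - ρ) ^ (d - w)

/-- The binomial probabilities. -/
def bin (p : ℝ) (n w : ℕ) : ℝ := n.choose w * p ^ w * (1 - p) ^ (n - w)

/-- The upper tail probabilities of the fair binomial distribution. -/
def tail (n w : ℕ) : ℝ := ∑ v ∈ Finset.range (n + 1), if w ≤ v then bin (1 / 2) n v else 0

lemma lik_nonneg {ρ : ℝ} (h0 : 0 ≤ ρ) (h1 : ρ ≤ 1) (d w : ℕ) : 0 ≤ lik ρ d w :=
  mul_nonneg (pow_nonneg (by linarith) _) (pow_nonneg (by linarith) _)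

lemma noise_eq_lik (ρ : ℝ) (x z : Cube d) :
    noise ρ x z = (1 / 2) ^ d * lik ρ d (agree x z) := by
  have hle : agree x z ≤ d :=
    (Finset.card_filter_le _ _).trans_eq (Finset.card_fin d)
  have hc : (Finset.univ.filter fun i => ¬ x i = z i).card = d - agree x z := by
    have := Finset.card_filter_add_card_filter_not (s := (Finset.univ : Finset (Fin d)))
      (fun i => x i = z i)
    simp only [Finset.card_univ, Fintype.card_fin] at this
    unfold agree
    omega
  unfold noise bitNoise
  rw [Finset.prod_ite, Finset.prod_const, Finset.prod_const, hc, lik,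
    show ((1 / 2 : ℝ)) ^ d = (1 / 2) ^ agree x z * (1 / 2) ^ (d - agree x z) by
      rw [← pow_add, Nat.add_sub_cancel' hle]]
  change ((1 + ρ) / 2) ^ agree x z * _ = _
  rw [div_pow, div_pow, one_div, inv_pow, inv_pow]
  ring

lemma half_pow_mul_choose_mul_lik (ρ : ℝ) {w : ℕ} (hw : w ≤ d) :
    (1 / 2) ^ d * (d.choose w * lik ρ d w) = bin ((1 + ρ) / 2) d w := by
  obtain ⟨e, rfl⟩ := Nat.exists_eq_add_of_le hw
  have : 1 - (1 + ρ) / 2 = (1 - ρ) / 2 := by ring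
  rw [bin, lik, this, Nat.add_sub_cancel_left, div_pow (1 + ρ), div_pow (1 - ρ), one_div, inv_pow,
    pow_add]
  field_simp

lemma bin_half {n w : ℕ} (hw : w ≤ n) : bin (1 / 2) n w = (1 / 2) ^ n * n.choose w := by
  rw [bin, mul_comm, show (1 : ℝ) - 1 / 2 = 1 / 2 by norm_num, mul_left_comm, ← pow_add,
    Nat.sub_add_cancel hw, mul_comm]

/-- For fixed z, a string is determined by the set of indices where it agrees with z. -/
lemma sum_agree (f : ℕ → ℝ) (z : Cube d) :
    ∑ x, f (agree x z) = ∑ w ∈ Finset.range (d + 1), d.choose w * f w := by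
  have h := Finset.sum_powerset_apply_card f (x := (Finset.univ : Finset (Fin d)))
  simp only [Finset.card_univ, Fintype.card_fin, nsmul_eq_mul] at h
  rw [← h, Finset.powerset_univ]
  refine Finset.sum_bij' (fun x _ => Finset.univ.filter fun i => x i = z i)
    (fun s _ i => if i ∈ s then z i else !z i) (by simp) (by simp) ?_ ?_ fun _ _ => rfl
  · intro x _
    ext i
    by_cases hi : x i = z i
    · simp [hi]
    · simp only [Finset.mem_filter, Finset.mem_univ, true_and, hi, if_false]
      cases h1 : x i <;> cases h2 : z i <;> simp_all
  · intro s _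
    ext i
    by_cases hi : i ∈ s <;> simp [hi]

lemma agree_comm (x z : Cube d) : agree x z = agree z x := by simp [agree, eq_comm]

lemma sum_agree' (f : ℕ → ℝ) (x : Cube d) :
    ∑ z, f (agree x z) = ∑ w ∈ Finset.range (d + 1), d.choose w * f w := by
  simp_rw [agree_comm x, sum_agree]

lemma success_term_sum (F : (Fin k → Cube d) → Fin k → Cube d → ℝ) (C : ℝ) :
    ∑ X, ∑ j, ∑ z, C * F X j z = C * ∑ X, ∑ z, ∑ j, F X j z := by
  simp_rw [Finset.mul_sum]
  exact Finset.sum_congr rfl fun X _ => Finset.sum_comm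

lemma half_pow_mul_card_cube (d : ℕ) : ((1 / 2 : ℝ) ^ d) * Fintype.card (Cube d) = 1 := by
  simp

/-- No protocol succeeds much more often than the likelihood of the right index exceeds `τ`. -/
theorem Protocol.success_le [NeZero k] (P : Protocol k d) {ρ : ℝ} (h0 : 0 ≤ ρ) (h1 : ρ ≤ 1)
    {τ : ℝ} (hτ : 0 ≤ τ) :
    P.success ρ ≤ τ / k +
      ∑ w ∈ Finset.range (d + 1), if τ < lik ρ d w then bin ((1 + ρ) / 2) d w else 0 := by
  have hk : (k : ℝ) ≠ 0 := by exact_mod_cast NeZero.ne k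
  have hg1 (X : Fin k → Cube d) (z : Cube d) (j : Fin k) : P.guess X z j ≤ 1 := by
    rw [← P.sum_guess X z]
    exact Finset.single_le_sum (fun j _ => P.guess_nonneg _ _ j) (Finset.mem_univ _)
  set h : ℕ → ℝ := fun w => if τ < lik ρ d w then lik ρ d w else 0
  have hh (w : ℕ) : 0 ≤ h w := by
    simp only [h]; split_ifs
    · exact lik_nonneg h0 h1 _ _
    · exact le_rfl
  set c : ℝ := (1 / 2) ^ d
  have hc : 0 ≤ c := by positivity
  have hcard : c * 2 ^ d = 1 := by simp [c]
  -- Likelihood times guess is at most τ times guess, plus the likelihood itself where it exceeds τ.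
  -- Guesses sum to 1 over j, so the first part contributes τ/k.
  calc P.success ρ ≤ ∑ X : Fin k → Cube d, ∑ j, ∑ z, c ^ k * (k : ℝ)⁻¹ *
        (c * τ * P.guess X z j + c * h (agree (X j) z)) := by
        unfold Protocol.success
        refine Finset.sum_le_sum fun X _ => Finset.sum_le_sum fun j _ =>
          Finset.sum_le_sum fun z _ => ?_
        rw [mul_assoc]
        refine mul_le_mul_of_nonneg_left ?_ (by positivity)
        rw [noise_eq_lik, mul_assoc, mul_assoc, ← mul_add]
        refine mul_le_mul_of_nonneg_left ?_ hc
        have hg0 := P.guess_nonneg X z j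
        simp only [h]
        split_ifs with hw
        · exact (mul_le_of_le_one_right (lik_nonneg h0 h1 _ _) (hg1 X z j)).trans
            (le_add_of_nonneg_left (mul_nonneg hτ hg0))
        · rw [add_zero]
          exact mul_le_mul_of_nonneg_right (not_lt.1 hw) hg0
    _ = τ / k + c * ∑ w ∈ Finset.range (d + 1), d.choose w * h w := by
        simp_rw [mul_add, Finset.sum_add_distrib]
        congr 1
        · simp_rw [success_term_sum fun X j z => c * τ * P.guess X z j, ← Finset.mul_sum,
            P.sum_guess]
          simp only [Finset.sum_const, Finset.card_univ, Fintype.card_pi, Fintype.card_bool,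
            Finset.prod_const, Fintype.card_fin, nsmul_eq_mul, Nat.cast_pow, Nat.cast_ofNat,
            mul_one]
          have : c ^ k * (2 ^ d) ^ k = 1 := by rw [← mul_pow, hcard, one_pow]
          have h2 : c ^ k * (2 ^ d) ^ k * (c * 2 ^ d) = 1 := by rw [this, hcard, one_mul]
          linear_combination (τ * (k : ℝ)⁻¹) * h2
        · simp_rw [← Finset.mul_sum, sum_agree']
          simp only [Finset.sum_const, Finset.card_univ, Fintype.card_pi, Fintype.card_bool,
            Finset.prod_const, Fintype.card_fin, nsmul_eq_mul, Nat.cast_pow, Nat.cast_ofNat]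
          have : c ^ k * (2 ^ d) ^ k = 1 := by rw [← mul_pow, hcard, one_pow]
          have hkk : (k : ℝ)⁻¹ * k = 1 := inv_mul_cancel₀ hk
          have h2 : c ^ k * (2 ^ d) ^ k * ((k : ℝ)⁻¹ * k) = 1 := by rw [this, hkk, one_mul]
          linear_combination (c * ∑ w ∈ Finset.range (d + 1), d.choose w * h w) * h2
    _ = _ := by
        congr 1
        rw [Finset.mul_sum]
        refine Finset.sum_congr rfl fun w hw => ?_
        simp only [h]
        split_ifs
        · exact half_pow_mul_choose_mul_lik ρ (Nat.lt_succ_iff.1 (Finset.mem_range.1 hw))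
        · simp

/-! ### The success of the nearest neighbor rule -/

lemma sum_pi_prod {α : Type*} [Fintype α] (f : Fin k → α → ℝ) :
    ∑ X : Fin k → α, ∏ i, f i (X i) = ∏ i, ∑ a, f i a := by
  rw [Finset.prod_univ_sum, Fintype.piFinset_univ]

lemma sum_pi_single {α : Type*} [Fintype α] {c : ℝ} (hc : c * Fintype.card α = 1)
    (j : Fin k) (f : α → ℝ) :
    ∑ X : Fin k → α, c ^ k * f (X j) = c * ∑ x, f x := by
  have h (X : Fin k → α) : c ^ k * f (X j) = ∏ i, c * if i = j then f (X i) else 1 := by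
    rw [Finset.prod_mul_distrib]; simp
  simp_rw [h]
  rw [sum_pi_prod fun i a => c * if i = j then f a else 1]
  have (i : Fin k) : ∑ a, c * (if i = j then f a else 1) = if i = j then c * ∑ a, f a else 1 := by
    split_ifs
    · rw [Finset.mul_sum]
    · simpa [mul_comm] using hc
  simp_rw [this]
  simp

lemma sum_pi_pair {α : Type*} [Fintype α] [DecidableEq α] {c : ℝ} (hc : c * Fintype.card α = 1)
    {j l : Fin k} (hjl : l ≠ j) (F : α → α → ℝ) :
    ∑ X : Fin k → α, c ^ k * F (X j) (X l) = c * ∑ x, c * ∑ y, F x y := by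
  have hprod (f g : α → ℝ) :
      ∑ X : Fin k → α, c ^ k * (f (X j) * g (X l)) = c * (∑ x, f x) * (c * ∑ y, g y) := by
    have h (X : Fin k → α) : c ^ k * (f (X j) * g (X l)) =
        ∏ i, c * ((if i = j then f (X i) else 1) * if i = l then g (X i) else 1) := by
      rw [Finset.prod_mul_distrib, Finset.prod_mul_distrib]; simp
    simp_rw [h]
    rw [sum_pi_prod fun i a => c * ((if i = j then f a else 1) * if i = l then g a else 1)]
    have (i : Fin k) : ∑ a, c * ((if i = j then f a else 1) * if i = l then g a else 1) =
        (if i = j then c * ∑ a, f a else 1) * (if i = l then c * ∑ a, g a else 1) := by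
      by_cases h1 : i = j
      · have : i ≠ l := fun h2 => hjl (h2 ▸ h1)
        simp [h1, hjl.symm, Finset.mul_sum]
      · by_cases h2 : i = l
        · simp [h2, hjl, Finset.mul_sum]
        · simpa [h1, h2, mul_comm] using hc
    simp_rw [this]
    rw [Finset.prod_mul_distrib]
    simp
  -- Expanding in indicators of `X j` reduces a general F to the product case.
  have hF (X : Fin k → α) : F (X j) (X l) = ∑ x, (if X j = x then 1 else 0) * F x (X l) := by
    simp
  simp_rw [hF, Finset.mul_sum]
  rw [Finset.sum_comm]
  refine Finset.sum_congr rfl fun x _ => ?_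
  rw [hprod (fun a => if a = x then 1 else 0) (F x)]
  simp [Finset.mul_sum]

open Classical in
/-- The index of the string that agrees most with `z`, if there is only one. -/
def nearest [NeZero k] (X : Fin k → Cube d) (z : Cube d) : Fin k :=
  -- The default 0 on ties is harmless: the success bound claims nothing positive for ties.
  if h : ∃ j, ∀ l, l ≠ j → agree (X l) z < agree (X j) z then h.choose else 0

lemma nearest_eq [NeZero k] {X : Fin k → Cube d} {z : Cube d} {j : Fin k}
    (h : ∀ l, l ≠ j → agree (X l) z < agree (X j) z) : nearest X z = j := by
  have hex : ∃ j, ∀ l, l ≠ j → agree (X l) z < agree (X j) z := ⟨j, h⟩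
  rw [nearest, dif_pos hex]
  by_contra hne
  exact lt_asymm (h _ hne) (hex.choose_spec j (Ne.symm hne))

/-- Alice sends all examples and Bob outputs the index of the nearest one. -/
def nearestProtocol (k d : ℕ) [NeZero k] : Protocol k d where
  Msg := Fin k → Cube d
  alice := Kernel.id
  bob := Kernel.deterministic (fun p => nearest p.1 p.2) .of_discrete

lemma Protocol.guess_of_alice_eq_dirac (P : Protocol k d) {X : Fin k → Cube d} {m : P.Msg}
    (h : P.alice X = Measure.dirac m) (z : Cube d) (j : Fin k) :
    P.guess X z j = (P.bob (m, z)).real {j} := by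
  rw [Protocol.guess, h, integral_dirac' _ _ (P.measurable_bob_real z j).stronglyMeasurable]

lemma guess_nearestProtocol [NeZero k] (X : Fin k → Cube d) (z : Cube d) (j : Fin k) :
    (nearestProtocol k d).guess X z j = if nearest X z = j then 1 else 0 := by
  have hb : (nearestProtocol k d).bob (X, z) = Measure.dirac (nearest X z) :=
    Kernel.deterministic_apply (f := fun p : (Fin k → Cube d) × Cube d => nearest p.1 p.2)
      .of_discrete _
  rw [(nearestProtocol k d).guess_of_alice_eq_dirac (Kernel.id_apply X), measureReal_def]
  refine (congrArg (fun μ : Measure (Fin k) => (μ {j}).toReal) hb).trans ?_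
  simp only [Measure.dirac_apply]
  by_cases h : nearest X z = j <;> simp [h, Set.indicator]

/-- Union bound over the k - 1 wrong strings, each of which has fair binomial agreement with z. The
cutoff `w₀` discards the small counts, for which the bound may be negative. -/
theorem le_success_nearestProtocol [NeZero k] {ρ : ℝ} (h0 : 0 ≤ ρ) (h1 : ρ ≤ 1) (w₀ : ℕ) :
    ∑ w ∈ Finset.range (d + 1),
      (if w₀ ≤ w then bin ((1 + ρ) / 2) d w * (1 - (k - 1) * tail d w) else 0) ≤
      (nearestProtocol k d).success ρ := by
  have hk : (k : ℝ) ≠ 0 := by exact_mod_cast NeZero.ne k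
  set h : ℕ → ℝ := fun w => if w₀ ≤ w then lik ρ d w else 0
  have hh (w : ℕ) : 0 ≤ h w := by
    simp only [h]; split_ifs
    · exact lik_nonneg h0 h1 _ _
    · exact le_rfl
  set c : ℝ := (1 / 2) ^ d
  have hc : 0 ≤ c := by positivity
  have hcard : c * Fintype.card (Cube d) = 1 := half_pow_mul_card_cube d
  have hcard' : (Fintype.card (Cube d) : ℝ) = 2 ^ d := by simp
  have ht (z : Cube d) (w : ℕ) : c * ∑ y : Cube d, (if w ≤ agree y z then 1 else 0) = tail d w := by
    rw [sum_agree (fun v => if w ≤ v then 1 else 0), tail, Finset.mul_sum]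
    refine Finset.sum_congr rfl fun v hv => ?_
    split_ifs
    · rw [bin_half (Nat.lt_succ_iff.1 (Finset.mem_range.1 hv)), mul_one]
    · simp
  calc _ = ∑ j : Fin k, ∑ z : Cube d, (k : ℝ)⁻¹ * c * (c * ∑ x, h (agree x z) -
        ∑ l ∈ Finset.univ.erase j,
          c * ∑ x, c * ∑ y, h (agree x z) * if agree x z ≤ agree y z then 1 else 0) := by
        simp_rw [← Finset.mul_sum _ _ (h _), mul_left_comm c (h _), ht]
        simp only [Finset.sum_const, Finset.card_erase_of_mem (Finset.mem_univ _),
          Finset.card_univ, Fintype.card_fin, nsmul_eq_mul, Nat.cast_sub (NeZero.one_le (n := k)),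
          Nat.cast_one]
        simp_rw [sum_agree h, sum_agree fun w => h w * tail d w]
        simp only [Finset.sum_const, Finset.card_univ, nsmul_eq_mul, hcard']
        rw [hcard'] at hcard
        have e : (k : ℝ) * (2 ^ d * ((k : ℝ)⁻¹ * c *
            (c * ∑ w ∈ Finset.range (d + 1), d.choose w * h w -
              (k - 1) * (c * ∑ w ∈ Finset.range (d + 1), d.choose w * (h w * tail d w))))) =
            c * ∑ w ∈ Finset.range (d + 1), d.choose w * h w -
              (k - 1) * (c * ∑ w ∈ Finset.range (d + 1), d.choose w * (h w * tail d w)) := by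
          have hkk : (k : ℝ)⁻¹ * k = 1 := inv_mul_cancel₀ hk
          have h2 : (k : ℝ)⁻¹ * k * (c * 2 ^ d) = 1 := by rw [hkk, hcard, one_mul]
          linear_combination (c * ∑ w ∈ Finset.range (d + 1), d.choose w * h w -
              (k - 1) * (c * ∑ w ∈ Finset.range (d + 1), d.choose w * (h w * tail d w))) * h2
        rw [e]
        simp_rw [Finset.mul_sum]
        rw [← Finset.sum_sub_distrib]
        refine Finset.sum_congr rfl fun w hw => ?_
        have hb := half_pow_mul_choose_mul_lik ρ (Nat.lt_succ_iff.1 (Finset.mem_range.1 hw))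
        simp only [h]
        split_ifs
        · rw [← hb]; ring
        · simp
    _ = ∑ j : Fin k, ∑ z : Cube d, (k : ℝ)⁻¹ * c * ∑ X : Fin k → Cube d, c ^ k *
          (h (agree (X j) z) - ∑ l ∈ Finset.univ.erase j,
            h (agree (X j) z) * if agree (X j) z ≤ agree (X l) z then 1 else 0) := by
        refine Finset.sum_congr rfl fun j _ => Finset.sum_congr rfl fun z _ => ?_
        congr 1
        simp_rw [mul_sub, Finset.sum_sub_distrib, Finset.mul_sum (Finset.univ.erase j)]
        rw [sum_pi_single hcard j fun x => h (agree x z), Finset.sum_comm]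
        congr 1
        refine Finset.sum_congr rfl fun l hl => ?_
        exact (sum_pi_pair hcard (Finset.ne_of_mem_erase hl) fun x y =>
          h (agree x z) * if agree x z ≤ agree y z then 1 else 0).symm
    _ = ∑ X : Fin k → Cube d, ∑ j : Fin k, ∑ z : Cube d, c ^ k * (k : ℝ)⁻¹ * (c *
          (h (agree (X j) z) - ∑ l ∈ Finset.univ.erase j,
            h (agree (X j) z) * if agree (X j) z ≤ agree (X l) z then 1 else 0)) := by
        simp_rw [Finset.mul_sum Finset.univ]
        rw [Finset.sum_comm' (t' := Finset.univ) (s' := fun _ => Finset.univ) (by simp)]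
        conv_rhs => rw [Finset.sum_comm]
        rw [Finset.sum_comm]
        refine Finset.sum_congr rfl fun j _ => ?_
        rw [Finset.sum_comm]
        refine Finset.sum_congr rfl fun X _ => Finset.sum_congr rfl fun z _ => ?_
        ring
    _ ≤ _ := by
        unfold Protocol.success
        refine Finset.sum_le_sum fun X _ => Finset.sum_le_sum fun j _ =>
          Finset.sum_le_sum fun z _ => ?_
        rw [mul_assoc (c ^ k * (k : ℝ)⁻¹)]
        refine mul_le_mul_of_nonneg_left ?_ (by positivity)
        rw [noise_eq_lik, mul_assoc]
        refine mul_le_mul_of_nonneg_left ?_ hc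
        rw [← Finset.mul_sum, ← mul_one_sub, guess_nearestProtocol]
        set S : ℝ := ∑ l ∈ Finset.univ.erase j, if agree (X j) z ≤ agree (X l) z then 1 else 0
        have hS : 0 ≤ S := Finset.sum_nonneg fun l _ => by split_ifs <;> norm_num
        have hl : h (agree (X j) z) ≤ lik ρ d (agree (X j) z) := by
          simp only [h]; split_ifs
          · exact le_rfl
          · exact lik_nonneg h0 h1 _ _
        split_ifs with hn
        · rw [mul_one]
          exact (mul_le_of_le_one_right (hh _) (by linarith)).trans hl
        · rw [mul_zero]
          -- If the rule misses j, some other string agrees with z at least as much, so the bracket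
          -- is at most 0.
          refine mul_nonpos_of_nonneg_of_nonpos (hh _) (sub_nonpos.2 ?_)
          obtain ⟨l, hlj, hle⟩ : ∃ l, l ≠ j ∧ agree (X j) z ≤ agree (X l) z := by
            by_contra! hcon
            exact hn (nearest_eq hcon)
          calc (1 : ℝ) = if agree (X j) z ≤ agree (X l) z then 1 else 0 := by rw [if_pos hle]
            _ ≤ S := Finset.single_le_sum (f := fun l =>
                if agree (X j) z ≤ agree (X l) z then (1 : ℝ) else 0)
                (fun l _ => by split_ifs <;> norm_num)
                (Finset.mem_erase.2 ⟨hlj, Finset.mem_univ l⟩)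

/-! ### Binomial distributions: Chebyshev, mixtures, symmetry -/

lemma bin_nonneg {p : ℝ} (h0 : 0 ≤ p) (h1 : p ≤ 1) (n w : ℕ) : 0 ≤ bin p n w :=
  mul_nonneg (mul_nonneg (Nat.cast_nonneg _) (pow_nonneg h0 _)) (pow_nonneg (by linarith) _)

lemma sum_bin (p : ℝ) (n : ℕ) : ∑ w ∈ Finset.range (n + 1), bin p n w = 1 := by
  have := add_pow p (1 - p) n
  rw [add_sub_cancel, one_pow] at this
  rw [this]
  exact Finset.sum_congr rfl fun w _ => by rw [bin]; ring

lemma sum_bin_mul_sq (p : ℝ) (n : ℕ) :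
    ∑ w ∈ Finset.range (n + 1), bin p n w * (w - n * p) ^ 2 = n * p * (1 - p) := by
  have := congrArg (Polynomial.eval p) (bernsteinPolynomial.variance ℝ n)
  simp only [Polynomial.eval_finsetSum, Polynomial.eval_mul, Polynomial.eval_pow,
    Polynomial.eval_sub, Polynomial.eval_X, Polynomial.eval_natCast, Polynomial.eval_one,
    nsmul_eq_mul, bernsteinPolynomial] at this
  rw [← this]
  exact Finset.sum_congr rfl fun w _ => by rw [bin]; ring

/-- Chebyshev's inequality for the binomial distribution. -/
lemma sum_bin_le_of_sq_le {p : ℝ} (h0 : 0 ≤ p) (h1 : p ≤ 1) (n : ℕ) {y : ℝ} (hy : 0 < y)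
    (Q : ℕ → Prop) [DecidablePred Q] (hQ : ∀ w, Q w → y ^ 2 ≤ (w - n * p) ^ 2) :
    ∑ w ∈ Finset.range (n + 1), (if Q w then bin p n w else 0) ≤ n * p / y ^ 2 := by
  rw [le_div_iff₀ (by positivity)]
  calc _ ≤ ∑ w ∈ Finset.range (n + 1), bin p n w * (w - n * p) ^ 2 := by
        rw [Finset.sum_mul]
        refine Finset.sum_le_sum fun w _ => ?_
        have hb := bin_nonneg h0 h1 n w
        split_ifs with h
        · exact mul_le_mul_of_nonneg_left (hQ w h) hb
        · rw [zero_mul]; positivity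
    _ = n * p * (1 - p) := sum_bin_mul_sq p n
    _ ≤ n * p := mul_le_of_le_one_right (by positivity) (by linarith)

/-- A binomial variable with parameter `(1 + ρ) / 2` is a mixture of shifted fair ones. -/
lemma sum_bin_mixture (ρ : ℝ) (d : ℕ) (g : ℕ → ℝ) :
    ∑ w ∈ Finset.range (d + 1), bin ((1 + ρ) / 2) d w * g w =
      ∑ f ∈ Finset.range (d + 1), bin ρ d f *
        ∑ v ∈ Finset.range (d - f + 1), bin (1 / 2) (d - f) v * g (f + v) := by
  -- Write (1 + ρ)/2 = ρ + q: an agreement is either forced, or a free index that agrees by a fair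
  -- coin. Then f counts the forced indices.
  set q := (1 - ρ) / 2
  have hq : (1 + ρ) / 2 = ρ + q := by simp only [q]; ring
  have hq' : 1 - (ρ + q) = q := by simp only [q]; ring
  calc _ = ∑ w ∈ Finset.range (d + 1), ∑ f ∈ Finset.range (w + 1),
        d.choose w * (ρ ^ f * q ^ (w - f) * w.choose f) * q ^ (d - w) * g w := by
        refine Finset.sum_congr rfl fun w _ => ?_
        rw [bin, hq, hq', add_pow, Finset.mul_sum, Finset.sum_mul, Finset.sum_mul]
    _ = ∑ f ∈ Finset.range (d + 1), ∑ w ∈ Finset.Ico f (d + 1),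
        d.choose w * (ρ ^ f * q ^ (w - f) * w.choose f) * q ^ (d - w) * g w :=
        Finset.sum_comm' fun w f => by
          simp only [Finset.mem_range, Finset.mem_Ico]; omega
    _ = _ := by
        refine Finset.sum_congr rfl fun f hf => ?_
        have hfd : f ≤ d := Nat.lt_succ_iff.1 (Finset.mem_range.1 hf)
        rw [Finset.sum_Ico_eq_sum_range, Finset.mul_sum, Nat.succ_sub hfd]
        refine Finset.sum_congr rfl fun v hv => ?_
        have hv' : v ≤ d - f := Nat.lt_succ_iff.1 (Finset.mem_range.1 hv)
        have hch := Nat.choose_mul (n := d) (k := f + v) (s := f) (by omega)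
        rw [Nat.add_sub_cancel_left] at hch
        have hch' : (d.choose (f + v) : ℝ) * (f + v).choose f =
            d.choose f * (d - f).choose v := by exact_mod_cast hch
        have hpow : (1 - ρ) ^ (d - f) * (1 / 2) ^ (d - f) = q ^ v * q ^ (d - (f + v)) := by
          rw [← mul_pow, ← pow_add]
          congr 1
          · simp only [q]; ring
          · omega
        rw [bin_half hv', Nat.add_sub_cancel_left, bin]
        linear_combination (ρ ^ f * q ^ v * q ^ (d - (f + v)) * g (f + v)) * hch' -
          (d.choose f * ρ ^ f * (d - f).choose v * g (f + v)) * hpow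

lemma bin_half_symm {n v : ℕ} (hv : v ≤ n) : bin (1 / 2) n (n - v) = bin (1 / 2) n v := by
  rw [bin_half hv, bin_half (Nat.sub_le _ _), Nat.choose_symm hv]

lemma sum_bin_half_reflect (n : ℕ) (g : ℕ → ℝ) :
    ∑ v ∈ Finset.range (n + 1), bin (1 / 2) n v * g v =
      ∑ v ∈ Finset.range (n + 1), bin (1 / 2) n v * g (n - v) := by
  rw [← Finset.sum_range_reflect]
  refine Finset.sum_congr rfl fun v hv => ?_
  have : v ≤ n := Nat.lt_succ_iff.1 (Finset.mem_range.1 hv)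
  rw [Nat.add_sub_cancel, bin_half_symm this]

/-- The event and its mirror image under v ↦ n - v are disjoint and equally likely. -/
lemma sum_bin_half_gt_le (n : ℕ) :
    ∑ v ∈ Finset.range (n + 1), bin (1 / 2) n v * (if n < 2 * v then 1 else 0) ≤ 1 / 2 := by
  have h1 := sum_bin_half_reflect n fun v => if n < 2 * v then 1 else 0
  have h2 : ∑ v ∈ Finset.range (n + 1), bin (1 / 2) n v * (if n < 2 * v then 1 else 0) +
      ∑ v ∈ Finset.range (n + 1), bin (1 / 2) n v * (if n < 2 * (n - v) then 1 else 0) ≤ 1 := by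
    refine le_of_le_of_eq ?_ (sum_bin (1 / 2) n)
    rw [← Finset.sum_add_distrib]
    refine Finset.sum_le_sum fun v hv => ?_
    have hb := bin_nonneg (p := 1 / 2) (by norm_num) (by norm_num) n v
    rw [← mul_add]
    refine mul_le_of_le_one_right hb ?_
    split_ifs <;> first | omega | norm_num
  linarith

lemma half_le_tail (n : ℕ) : 1 / 2 ≤ tail n ((n + 1) / 2) := by
  have h0 := sum_bin_half_gt_le n
  have h1 := sum_bin_half_reflect n fun v => if n < 2 * v then 1 else 0
  have h2 : ∑ v ∈ Finset.range (n + 1), bin (1 / 2) n v * (if n < 2 * (n - v) then 1 else 0) +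
      tail n ((n + 1) / 2) = 1 := by
    refine Eq.trans ?_ (sum_bin (1 / 2) n)
    rw [tail, ← Finset.sum_add_distrib]
    refine Finset.sum_congr rfl fun v hv => ?_
    have : v ≤ n := Nat.lt_succ_iff.1 (Finset.mem_range.1 hv)
    split_ifs <;> first | omega | simp
  linarith

/-- If the likelihood exceeds `τ` only at more than `d (1 + ρ) / 2` agreements, by a margin, then
it does so with probability little more than one half. -/
theorem sum_lik_gt_le {ρ τ x : ℝ} (h0 : 0 ≤ ρ) (h1 : ρ ≤ 1) (hx : 0 < x)
    (h : ∀ w ≤ d, τ < lik ρ d w → d * ρ + x < 2 * w - d) :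
    ∑ w ∈ Finset.range (d + 1), (if τ < lik ρ d w then bin ((1 + ρ) / 2) d w else 0) ≤
      1 / 2 + d * ρ / x ^ 2 := by
  have hb := bin_nonneg h0 h1 d
  calc _ = ∑ w ∈ Finset.range (d + 1), bin ((1 + ρ) / 2) d w *
        (if τ < lik ρ d w then 1 else 0) := by simp
    _ ≤ ∑ f ∈ Finset.range (d + 1), bin ρ d f *
        (1 / 2 + if d * ρ + x ≤ f then 1 else 0) := by
        rw [sum_bin_mixture]
        refine Finset.sum_le_sum fun f hf => mul_le_mul_of_nonneg_left ?_ (hb f)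
        have hfd : f ≤ d := Nat.lt_succ_iff.1 (Finset.mem_range.1 hf)
        have hb' := bin_nonneg (p := 1 / 2) (by norm_num) (by norm_num) (d - f)
        split_ifs with hfx
        · calc _ ≤ ∑ v ∈ Finset.range (d - f + 1), bin (1 / 2) (d - f) v :=
                Finset.sum_le_sum fun v _ => mul_le_of_le_one_right (hb' v) (by
                  split_ifs <;> norm_num)
            _ = 1 := sum_bin _ _
            _ ≤ _ := by norm_num
        -- For f < dρ + x the hypothesis forces 2v > d - f, which has fair probability at most 1/2.
        -- Larger f are left to Chebyshev.
        · rw [add_zero]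
          refine le_trans (Finset.sum_le_sum fun v hv => ?_) (sum_bin_half_gt_le (d - f))
          refine mul_le_mul_of_nonneg_left ?_ (hb' v)
          have hv' : v ≤ d - f := Nat.lt_succ_iff.1 (Finset.mem_range.1 hv)
          by_cases hl : τ < lik ρ d (f + v)
          · have := h (f + v) (by omega) hl
            push_cast at this
            have h2 : (d : ℝ) < f + 2 * v := by linarith
            have h3 : d < f + 2 * v := by exact_mod_cast h2
            rw [if_pos hl, if_pos (by omega)]
          · rw [if_neg hl]
            split_ifs <;> norm_num
    _ = 1 / 2 + ∑ f ∈ Finset.range (d + 1), if d * ρ + x ≤ f then bin ρ d f else 0 := by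
        simp_rw [mul_add, Finset.sum_add_distrib, ← Finset.sum_mul, sum_bin, one_mul, mul_ite,
          mul_one, mul_zero]
    _ ≤ _ := by
        gcongr
        exact sum_bin_le_of_sq_le h0 h1 d hx _ fun w hw =>
          pow_le_pow_left₀ hx.le (by linarith) 2

/-! ### Central binomial probabilities and atoms near the median -/

/-- The central binomial probability. -/
def central (m : ℕ) : ℝ := m.centralBinom / 4 ^ m

lemma central_pos (m : ℕ) : 0 < central m :=
  div_pos (Nat.cast_pos.2 (Nat.centralBinom_pos m)) (by positivity)

lemma central_succ (m : ℕ) : (2 * m + 2) * central (m + 1) = (2 * m + 1) * central m := by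
  have h : ((m : ℝ) + 1) * (m + 1).centralBinom = 2 * (2 * m + 1) * m.centralBinom := by
    exact_mod_cast Nat.succ_mul_centralBinom_succ m
  rw [central, central, pow_succ]
  field_simp
  linear_combination 2 * h

/-- Induction through the ratio (2m + 1)/(2m + 2). Here and in `le_central_sq_mul` the constants 3
and 16/5 enclose the true value π. -/
lemma central_sq_mul_le (m : ℕ) : central m ^ 2 * (3 * m + 1) ≤ 1 := by
  induction m with
  | zero => simp [central]
  | succ m ih =>
    have h := central_succ m
    have h2 : central (m + 1) ^ 2 * (2 * m + 2) ^ 2 = central m ^ 2 * (2 * m + 1) ^ 2 := by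
      rw [← mul_pow, ← mul_pow, mul_comm, h, mul_comm]
    have hc := sq_nonneg (central m)
    have hm : (0 : ℝ) ≤ m := Nat.cast_nonneg m
    push_cast
    refine le_of_mul_le_mul_right ?_ (show (0 : ℝ) < (2 * m + 2) ^ 2 * (3 * m + 1) by positivity)
    calc central (m + 1) ^ 2 * (3 * (m + 1) + 1) * ((2 * m + 2) ^ 2 * (3 * m + 1) : ℝ)
        = central m ^ 2 * (3 * m + 1) * ((2 * m + 1) ^ 2 * (3 * m + 4) : ℝ) := by
          linear_combination ((3 * (m + 1) + 1) * (3 * m + 1) : ℝ) * h2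
      _ ≤ 1 * ((2 * m + 1) ^ 2 * (3 * m + 4) : ℝ) := by gcongr
      _ ≤ _ := by nlinarith

lemma le_central_sq_mul {m : ℕ} (hm1 : 1 ≤ m) : 5 ≤ central m ^ 2 * (16 * m + 4) := by
  induction m, hm1 using Nat.le_induction with
  | base => norm_num [central, Nat.centralBinom, Nat.choose]
  | succ m hm1 ih =>
    have h := central_succ m
    have h2 : central (m + 1) ^ 2 * (2 * m + 2) ^ 2 = central m ^ 2 * (2 * m + 1) ^ 2 := by
      rw [← mul_pow, ← mul_pow, mul_comm, h, mul_comm]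
    have hm : (0 : ℝ) ≤ m := Nat.cast_nonneg m
    push_cast
    refine le_of_mul_le_mul_right ?_ (show (0 : ℝ) < (2 * m + 2) ^ 2 * (16 * m + 4) by positivity)
    calc 5 * ((2 * m + 2) ^ 2 * (16 * m + 4) : ℝ)
        ≤ 5 * ((2 * m + 1) ^ 2 * (16 * m + 20)) := by nlinarith
      _ ≤ central m ^ 2 * (16 * m + 4) * ((2 * m + 1) ^ 2 * (16 * m + 20)) := by gcongr
      _ = central (m + 1) ^ 2 * (16 * (m + 1) + 4) * ((2 * m + 2) ^ 2 * (16 * m + 4)) := by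
          linear_combination (-(16 * (m + 1) + 4) * (16 * m + 4) : ℝ) * h2

lemma bin_half_eq_zero {n v : ℕ} (hv : n < v) : bin (1 / 2) n v = 0 := by
  simp [bin, Nat.choose_eq_zero_of_lt hv]

lemma bin_half_two_mul (m : ℕ) : bin (1 / 2) (2 * m) m = central m := by
  rw [bin_half (by omega), central, Nat.centralBinom, pow_mul,
    show (1 / 2 : ℝ) ^ 2 = 4⁻¹ by norm_num, inv_pow, div_eq_inv_mul]

lemma bin_half_two_mul_le (m v : ℕ) : bin (1 / 2) (2 * m) v ≤ central m := by
  rcases le_or_gt v (2 * m) with h | h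
  · rw [← bin_half_two_mul, bin_half h, bin_half (by omega)]
    gcongr
    exact Nat.choose_le_centralBinom v m
  · rw [bin_half_eq_zero h]; exact (central_pos m).le

lemma bin_half_succ_succ (n v : ℕ) :
    bin (1 / 2) (n + 1) (v + 1) = (bin (1 / 2) n v + bin (1 / 2) n (v + 1)) / 2 := by
  rcases lt_trichotomy n v with h | rfl | h
  · rw [bin_half_eq_zero h, bin_half_eq_zero (by omega), bin_half_eq_zero (by omega)]; simp
  · rw [bin_half_eq_zero (Nat.lt_succ_self n), bin_half le_rfl, bin_half le_rfl]
    simp [pow_succ]; ring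
  · rw [bin_half (by omega), bin_half (by omega), bin_half (by omega), Nat.choose_succ_succ,
      pow_succ]
    push_cast; ring

lemma bin_half_succ_zero (n : ℕ) : bin (1 / 2) (n + 1) 0 = bin (1 / 2) n 0 / 2 := by
  rw [bin_half (by omega), bin_half (by omega), pow_succ]; simp; ring

lemma bin_half_le_central (n v : ℕ) : bin (1 / 2) n v ≤ central (n / 2) := by
  rcases Nat.even_or_odd' n with ⟨m, rfl | rfl⟩
  · rw [Nat.mul_div_cancel_left _ (by norm_num)]; exact bin_half_two_mul_le m v
  · rw [show (2 * m + 1) / 2 = m by omega]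
    cases v with
    | zero =>
      rw [bin_half_succ_zero]
      linarith [bin_half_two_mul_le m 0, central_pos m]
    | succ v =>
      rw [bin_half_succ_succ]
      linarith [bin_half_two_mul_le m v, bin_half_two_mul_le m (v + 1)]

/-- The step from l to l + 1 loses at most (2l + 1)/m times the central atom, and these odd numbers
sum to a square. -/
lemma le_bin_half_two_mul {m l : ℕ} (hl : l ≤ m) :
    central m * (1 - l ^ 2 / m) ≤ bin (1 / 2) (2 * m) (m - l) := by
  induction l with
  | zero => simp [← bin_half_two_mul]
  | succ l ih =>
    have hm : (0 : ℝ) < m := by exact_mod_cast (by omega : 0 < m)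
    have hle : (l : ℝ) + 1 ≤ m := by exact_mod_cast hl
    have hrec : bin (1 / 2) (2 * m) (m - (l + 1)) * (m + l + 1) =
        bin (1 / 2) (2 * m) (m - l) * (m - l) := by
      have h := Nat.choose_succ_right_eq (2 * m) (m - (l + 1))
      rw [show m - (l + 1) + 1 = m - l by omega,
        show 2 * m - (m - (l + 1)) = m + l + 1 by omega] at h
      have h' : ((2 * m).choose (m - l) : ℝ) * (m - l) =
          (2 * m).choose (m - (l + 1)) * (m + l + 1) := by
        have := congrArg (Nat.cast (R := ℝ)) h
        push_cast [Nat.cast_sub (show l ≤ m by omega)] at this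
        exact this
      rw [bin_half (by omega), bin_half (by omega)]
      linear_combination (-(1 / 2) ^ (2 * m) : ℝ) * h'
    have hb := bin_half_two_mul_le m (m - l)
    have hb0 := bin_nonneg (p := 1 / 2) (by norm_num) (by norm_num) (2 * m) (m - l)
    have hc := central_pos m
    have key : bin (1 / 2) (2 * m) (m - l) - central m * ((2 * l + 1) / m) ≤
        bin (1 / 2) (2 * m) (m - (l + 1)) := by
      have e : bin (1 / 2) (2 * m) (m - (l + 1)) =
          bin (1 / 2) (2 * m) (m - l) -
            bin (1 / 2) (2 * m) (m - l) * ((2 * l + 1) / (m + l + 1)) := by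
        rw [eq_sub_iff_add_eq]
        field_simp
        linear_combination hrec
      rw [e]
      gcongr
      linarith [show (0 : ℝ) ≤ l from Nat.cast_nonneg l]
    refine le_trans (le_of_eq ?_) ((sub_le_sub_right (ih (by omega)) _).trans key)
    push_cast
    field_simp
    ring

lemma le_bin_half {n l i : ℕ} (hl1 : 1 ≤ l) (hli : l ≤ i) (hi : i ≤ n / 2) :
    central (n / 2) * (1 - i ^ 2 / (n / 2 : ℕ)) ≤ bin (1 / 2) n ((n + 1) / 2 - l) := by
  have hmono (a m : ℕ) (ha : a ≤ i) :
      central m * (1 - (i : ℝ) ^ 2 / m) ≤ central m * (1 - (a : ℝ) ^ 2 / m) := by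
    have := (central_pos m).le
    gcongr
  rcases Nat.even_or_odd' n with ⟨m, rfl | rfl⟩
  · rw [show (2 * m + 1) / 2 = m by omega, show 2 * m / 2 = m by omega] at *
    exact (hmono l m hli).trans (le_bin_half_two_mul (hli.trans hi))
  -- By Pascal's rule an atom for odd n is the average of two adjacent atoms for n - 1.
  · rw [show (2 * m + 1 + 1) / 2 = m + 1 by omega] at *
    rw [show (2 * m + 1) / 2 = m by omega] at *
    have h1 := (hmono (l - 1) m (by omega)).trans (le_bin_half_two_mul (by omega))
    rw [show m - (l - 1) = m + 1 - l by omega] at h1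
    rcases (show l = m + 1 ∨ l ≤ m by omega) with h | h
    · omega
    · have h2 := (hmono l m hli).trans (le_bin_half_two_mul h)
      rw [show m + 1 - l = (m - l) + 1 by omega] at h1 ⊢
      rw [bin_half_succ_succ]
      linarith

/-- A lower bound on the fair binomial tail from a point a little below the mean. -/
lemma half_add_le_tail {n i w : ℕ} (hi : i ≤ n / 2) (hw : w + i ≤ (n + 1) / 2) :
    1 / 2 + i * (central (n / 2) * (1 - i ^ 2 / (n / 2 : ℕ))) ≤ tail n w := by
  set c := central (n / 2) * (1 - (i : ℝ) ^ 2 / (n / 2 : ℕ))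
  have hb := bin_nonneg (p := 1 / 2) (by norm_num) (by norm_num) n
  -- The i atoms just below ⌈n/2⌉ are added to the upper half.
  have hsum : (i : ℝ) * c ≤ ∑ l ∈ Finset.range i, bin (1 / 2) n ((n + 1) / 2 - (l + 1)) := by
    have := Finset.card_nsmul_le_sum (Finset.range i)
      (fun l => bin (1 / 2) n ((n + 1) / 2 - (l + 1))) c fun l hl =>
        le_bin_half (by omega) (by simpa using hl) hi
    simpa using this
  have himg : ∑ l ∈ Finset.range i, bin (1 / 2) n ((n + 1) / 2 - (l + 1)) =
      ∑ v ∈ (Finset.range i).image (fun l => (n + 1) / 2 - (l + 1)), bin (1 / 2) n v := by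
    rw [Finset.sum_image]
    intro a ha b hb h
    simp only [Finset.coe_range, Set.mem_Iio] at ha hb
    simp only at h
    omega
  have h1 := half_le_tail n
  rw [himg] at hsum
  calc _ ≤ tail n ((n + 1) / 2) +
        ∑ v ∈ (Finset.range i).image (fun l => (n + 1) / 2 - (l + 1)), bin (1 / 2) n v :=
        add_le_add h1 hsum
    _ ≤ tail n w := by
        rw [tail, tail, ← Finset.sum_filter, ← Finset.sum_filter, ← Finset.sum_union]
        · refine Finset.sum_le_sum_of_subset_of_nonneg ?_ fun v _ _ => hb v
          intro v hv
          simp only [Finset.mem_union, Finset.mem_filter, Finset.mem_range, Finset.mem_image]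
            at hv ⊢
          rcases hv with hv | ⟨l, hl, rfl⟩ <;> omega
        · rw [Finset.disjoint_left]
          intro v hv
          simp only [Finset.mem_filter, Finset.mem_range, Finset.mem_image, not_exists,
            not_and] at hv ⊢
          intro l hl
          omega

/-! ### Tails by change of measure -/

lemma lik_pos {ρ : ℝ} (h0 : 0 ≤ ρ) (h1 : ρ < 1) (d w : ℕ) : 0 < lik ρ d w :=
  mul_pos (pow_pos (by linarith) _) (pow_pos (by linarith) _)

lemma inv_lik_eq {ρ : ℝ} (h0 : 0 ≤ ρ) (h1 : ρ < 1) {v : ℕ} (hv : v ≤ d) :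
    (lik ρ d v)⁻¹ = ((1 - ρ) ^ d)⁻¹ * ((1 - ρ) / (1 + ρ)) ^ v := by
  obtain ⟨e, rfl⟩ := Nat.exists_eq_add_of_le hv
  have h2 : (1 + ρ) ≠ 0 := by linarith
  have h3 : (1 - ρ) ≠ 0 := by linarith
  rw [lik, Nat.add_sub_cancel_left, div_pow, pow_add]
  field_simp

lemma sum_inv_lik_le {ρ : ℝ} (h0 : 0 < ρ) (h1 : ρ < 1) {w : ℕ} (hw : w ≤ d) :
    ∑ v ∈ Finset.range (d + 1), (if w ≤ v then (lik ρ d v)⁻¹ else 0) ≤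
      (1 + ρ) / (2 * ρ) * (lik ρ d w)⁻¹ := by
  have hl0 : 0 ≤ (1 - ρ) / (1 + ρ) := div_nonneg (by linarith) (by linarith)
  have hl1 : (1 - ρ) / (1 + ρ) < 1 := by rw [div_lt_one (by linarith)]; linarith
  have hp : 0 < (1 - ρ) ^ d := pow_pos (by linarith) _
  have hset : (Finset.range (d + 1)).filter (fun v => w ≤ v) = Finset.Ico w (d + 1) := by
    ext v; simp only [Finset.mem_filter, Finset.mem_range, Finset.mem_Ico]; omega
  rw [← Finset.sum_filter, hset, inv_lik_eq h0.le h1 hw]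
  calc ∑ v ∈ Finset.Ico w (d + 1), (lik ρ d v)⁻¹
      = ((1 - ρ) ^ d)⁻¹ * ∑ v ∈ Finset.Ico w (d + 1), ((1 - ρ) / (1 + ρ)) ^ v := by
        rw [Finset.mul_sum]
        exact Finset.sum_congr rfl fun v hv =>
          inv_lik_eq h0.le h1 (Nat.lt_succ_iff.1 (Finset.mem_Ico.1 hv).2)
    _ ≤ ((1 - ρ) ^ d)⁻¹ * (((1 - ρ) / (1 + ρ)) ^ w / (1 - (1 - ρ) / (1 + ρ))) :=
        mul_le_mul_of_nonneg_left (geom_sum_Ico_le_of_lt_one hl0 hl1) (inv_nonneg.2 hp.le)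
    _ = _ := by
        have : 1 - (1 - ρ) / (1 + ρ) = 2 * ρ / (1 + ρ) := by
          field_simp; ring
        rw [this]
        field_simp

/-- A fair atom is the biased atom divided by the likelihood. Bounding biased atoms by A leaves a
geometric series of ratio (1 - ρ)/(1 + ρ). `sum_bin_mul_tail_le` sums this series a second time. -/
lemma tail_le_of_bin_le {ρ A : ℝ} (h0 : 0 < ρ) (h1 : ρ < 1)
    (hA : ∀ v ≤ d, bin ((1 + ρ) / 2) d v ≤ A) {w : ℕ} (hw : w ≤ d) :
    tail d w ≤ A * ((1 + ρ) / (2 * ρ) * (lik ρ d w)⁻¹) := by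
  have hA0 : 0 ≤ A := (bin_nonneg (by linarith) (by linarith) d w).trans (hA w hw)
  refine le_trans ?_ (mul_le_mul_of_nonneg_left (sum_inv_lik_le h0 h1 hw) hA0)
  rw [tail, Finset.mul_sum]
  refine Finset.sum_le_sum fun v hv => ?_
  have hv' : v ≤ d := Nat.lt_succ_iff.1 (Finset.mem_range.1 hv)
  have hl := lik_pos h0.le h1 d v
  split_ifs
  · rw [← div_eq_mul_inv, le_div_iff₀ hl, bin_half hv', mul_assoc,
      half_pow_mul_choose_mul_lik ρ hv']
    exact hA v hv'
  · simp

lemma sum_bin_mul_tail_le {ρ A : ℝ} (h0 : 0 < ρ) (h1 : ρ < 1)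
    (hA : ∀ v ≤ d, bin ((1 + ρ) / 2) d v ≤ A) {w₀ : ℕ} (hw : w₀ ≤ d) :
    ∑ w ∈ Finset.range (d + 1), (if w₀ ≤ w then bin ((1 + ρ) / 2) d w * tail d w else 0) ≤
      A ^ 2 * ((1 + ρ) / (2 * ρ)) ^ 2 * (lik ρ d w₀)⁻¹ := by
  have hA0 : 0 ≤ A := (bin_nonneg (by linarith) (by linarith) d w₀).trans (hA w₀ hw)
  calc _ ≤ ∑ w ∈ Finset.range (d + 1), A * (A * ((1 + ρ) / (2 * ρ))) *
        (if w₀ ≤ w then (lik ρ d w)⁻¹ else 0) := by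
        refine Finset.sum_le_sum fun w hw => ?_
        have hw' : w ≤ d := Nat.lt_succ_iff.1 (Finset.mem_range.1 hw)
        split_ifs
        · rw [mul_assoc A, mul_assoc A]
          have htail : 0 ≤ tail d w := Finset.sum_nonneg fun v _ => by
            split_ifs
            · exact bin_nonneg (by norm_num) (by norm_num) _ _
            · exact le_rfl
          exact mul_le_mul (hA w hw') (tail_le_of_bin_le h0 h1 hA hw') htail hA0
        · simp
    _ ≤ A * (A * ((1 + ρ) / (2 * ρ))) * ((1 + ρ) / (2 * ρ) * (lik ρ d w₀)⁻¹) := by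
        rw [← Finset.mul_sum]
        exact mul_le_mul_of_nonneg_left (sum_inv_lik_le h0 h1 hw) (by positivity)
    _ = _ := by ring

/-- Second-order Taylor expansion of log(1 ± ρ), with error at most 2ρ³ for each of the d factors.
-/
lemma abs_log_lik_sub_le {ρ : ℝ} (h0 : 0 ≤ ρ) (h1 : ρ ≤ 1 / 2) {w : ℕ} (hw : w ≤ d) :
    |Real.log (lik ρ d w) - ((2 * w - d) * ρ - d * ρ ^ 2 / 2)| ≤ 2 * d * ρ ^ 3 := by
  have hb : ρ ^ 3 / (1 - ρ) ≤ 2 * ρ ^ 3 := by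
    rw [div_le_iff₀ (by linarith)]
    nlinarith [pow_nonneg h0 3]
  have hp := Real.abs_log_sub_add_sum_range_le (x := -ρ)
    (by rw [abs_neg, abs_of_nonneg h0]; linarith) 2
  have hn := Real.abs_log_sub_add_sum_range_le (x := ρ) (by rw [abs_of_nonneg h0]; linarith) 2
  simp only [Finset.sum_range_succ, Finset.sum_range_zero, abs_neg, abs_of_nonneg h0] at hp hn
  norm_num at hp hn
  have hp' := abs_le.1 (hp.trans hb)
  have hn' := abs_le.1 (hn.trans hb)
  have hwd : (0 : ℝ) ≤ (d : ℝ) - w := sub_nonneg.2 (by exact_mod_cast hw)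
  have hw0 : (0 : ℝ) ≤ w := Nat.cast_nonneg w
  rw [lik, Real.log_mul (pow_pos (by linarith) _).ne' (pow_pos (by linarith) _).ne', Real.log_pow,
    Real.log_pow, Nat.cast_sub hw, abs_le]
  constructor <;>
  nlinarith [mul_le_mul_of_nonneg_left hp'.1 hw0, mul_le_mul_of_nonneg_left hp'.2 hw0,
    mul_le_mul_of_nonneg_left hn'.1 hwd, mul_le_mul_of_nonneg_left hn'.2 hwd]

/-! ### Numerical estimates with s = √d and t = ρ√d -/

lemma central_le {m : ℕ} {s : ℝ} (hs : 100 ≤ s) (hm : 0.98 * s ^ 2 ≤ 2 * m + 1) :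
    central m ≤ 0.83 / s := by
  have h := central_sq_mul_le m
  have hc := central_pos m
  rw [← pow_le_pow_iff_left₀ hc.le (by positivity) two_ne_zero, div_pow, le_div_iff₀ (by positivity)]
  have h2 : (1.452 : ℝ) * s ^ 2 ≤ 3 * m + 1 := by nlinarith
  nlinarith [sq_nonneg (central m), mul_le_mul_of_nonneg_left h2 (sq_nonneg (central m))]

lemma le_central {m : ℕ} {s : ℝ} (hs : 100 ≤ s) (hm1 : 1 ≤ m) (hm : 2 * (m : ℝ) ≤ s ^ 2) :
    0.79 / s ≤ central m := by
  have h := le_central_sq_mul hm1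
  have hc := central_pos m
  rw [← pow_le_pow_iff_left₀ (by positivity) hc.le two_ne_zero, div_pow, div_le_iff₀ (by positivity)]
  have h2 : (16 * m + 4 : ℝ) ≤ 8.001 * s ^ 2 := by nlinarith
  nlinarith [sq_nonneg (central m), mul_le_mul_of_nonneg_left h2 (sq_nonneg (central m))]

/-- An upper bound for the atoms of the number of agreements. -/
lemma bin_le_of_large {s t : ℝ} (ht : 10 ^ 7 ≤ t) (hs : t ^ 5 ≤ s) (hd : (d : ℝ) = s ^ 2) (w : ℕ) :
    bin ((1 + t / s) / 2) d w ≤ 0.836 / s := by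
  have ht0 : 0 < t := by linarith
  have hts : 10 ^ 7 * t ≤ s := by
    calc (10 : ℝ) ^ 7 * t ≤ t ^ 4 * t := by
          gcongr
          calc (10 : ℝ) ^ 7 ≤ t := ht
            _ = t ^ 1 := (pow_one t).symm
            _ ≤ t ^ 4 := pow_le_pow_right₀ (by linarith) (by norm_num)
      _ = t ^ 5 := by ring
      _ ≤ s := hs
  have hs0 : 0 < s := by linarith
  set ρ := t / s
  have hρ0 : 0 ≤ ρ := by positivity
  have hρ1 : ρ ≤ 1 := by rw [div_le_one hs0]; linarith
  have hdρ : d * ρ = t * s := by rw [hd]; simp only [ρ]; field_simp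
  rcases le_or_gt w d with hw | hw
  swap
  · rw [bin, Nat.choose_eq_zero_of_lt hw]; simp; positivity
  have hb := bin_nonneg hρ0 hρ1 d
  calc bin ((1 + ρ) / 2) d w
      = ∑ w' ∈ Finset.range (d + 1), bin ((1 + ρ) / 2) d w' * (if w' = w then 1 else 0) := by
        simp [Nat.lt_succ_of_le hw]
    -- If f < d/50, at least 0.98 d fair coins remain, so the atom is at most a central one.
    _ ≤ ∑ f ∈ Finset.range (d + 1), bin ρ d f *
        (0.83 / s + if (d : ℝ) / 50 ≤ f then 1 else 0) := by
        rw [sum_bin_mixture]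
        refine Finset.sum_le_sum fun f hf => mul_le_mul_of_nonneg_left ?_ (hb f)
        have hfd : f ≤ d := Nat.lt_succ_iff.1 (Finset.mem_range.1 hf)
        have hb' := bin_nonneg (p := 1 / 2) (by norm_num) (by norm_num) (d - f)
        split_ifs with h
        · calc _ ≤ ∑ v ∈ Finset.range (d - f + 1), bin (1 / 2) (d - f) v :=
                Finset.sum_le_sum fun v _ => mul_le_of_le_one_right (hb' v) (by
                  split_ifs <;> norm_num)
            _ = 1 := sum_bin _ _
            _ ≤ _ := by linarith [show 0 ≤ 0.83 / s by positivity]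
        · rw [add_zero]
          calc _ ≤ ∑ v ∈ Finset.range (d - f + 1),
                (if v = w - f then bin (1 / 2) (d - f) v else 0) := by
                refine Finset.sum_le_sum fun v _ => ?_
                have := hb' v
                split_ifs <;> first | omega | (simp only [mul_one, mul_zero, le_refl]; try exact this)
            _ ≤ bin (1 / 2) (d - f) (w - f) := by
                rw [Finset.sum_ite_eq']
                split_ifs
                · exact le_rfl
                · exact hb' _
            _ ≤ central ((d - f) / 2) := bin_half_le_central _ _
            _ ≤ _ := by
                refine central_le (by linarith) ?_
                have h1 : d ≤ 2 * ((d - f) / 2) + 1 + f := by omega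
                have h2 : (d : ℝ) ≤ 2 * ((d - f) / 2 : ℕ) + 1 + f := by exact_mod_cast h1
                rw [hd] at h h2
                linarith
    _ = 0.83 / s + ∑ f ∈ Finset.range (d + 1), if (d : ℝ) / 50 ≤ f then bin ρ d f else 0 := by
        simp_rw [mul_add, Finset.sum_add_distrib, ← Finset.sum_mul, sum_bin, one_mul, mul_ite,
          mul_one, mul_zero]
    _ ≤ 0.83 / s + d * ρ / (s ^ 2 / 100) ^ 2 := by
        gcongr
        refine sum_bin_le_of_sq_le hρ0 hρ1 d (by positivity) _ fun f hf => ?_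
        rw [hdρ]
        refine pow_le_pow_left₀ (by positivity) ?_ 2
        rw [hd] at hf
        nlinarith
    _ ≤ 0.83 / s + 0.006 / s := by
        refine add_le_add le_rfl ?_
        rw [hdρ, div_le_div_iff₀ (by positivity) hs0]
        have : t ≤ 0.0000006 * s ^ 2 := by nlinarith
        have h2 : t * s ^ 2 ≤ 0.0000006 * s ^ 2 * s ^ 2 := by gcongr
        nlinarith
    _ = _ := by ring

lemma exp_one_point_two_zero_one_le : Real.exp 1.201 ≤ 3.41 := by
  have h1 := Real.add_one_le_exp (-0.201)
  have h2 := Real.exp_one_lt_d9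
  have h3 : Real.exp 1.201 * Real.exp (-0.201) = Real.exp 1 := by
    rw [← Real.exp_add]; norm_num
  nlinarith [Real.exp_pos 1.201]

/-- The number of agreements exceeds a point a little below its mean with probability
noticeably larger than one half. -/
lemma le_sum_bin_of_large {s t : ℝ} (ht : 10 ^ 7 ≤ t) (hs : t ^ 5 ≤ s) (hd : (d : ℝ) = s ^ 2)
    {w₀ : ℕ} (hw₀ : 2 * (w₀ : ℝ) ≤ s ^ 2 + t * s - 1.2 * (s / t) + 2) :
    1 / 2 + 0.455 / t ≤
      ∑ w ∈ Finset.range (d + 1), (if w₀ ≤ w then bin ((1 + t / s) / 2) d w else 0) := by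
  have ht0 : 0 < t := by linarith
  have hq : 10 ^ 7 * t ^ 3 ≤ s / t := by
    rw [le_div_iff₀ ht0]
    calc 10 ^ 7 * t ^ 3 * t ≤ t * t ^ 3 * t := by gcongr
      _ = t ^ 5 := by ring
      _ ≤ s := hs
  set q := s / t
  have hsq : s = q * t := by simp only [q]; field_simp
  have hq0 : 10 ^ 7 ≤ q := by
    have := one_le_pow₀ (n := 3) (show 1 ≤ t by linarith)
    linarith
  have hs0 : 0 < s := by rw [hsq]; positivity
  have hst : 10 ^ 7 * t ≤ s := by rw [hsq]; gcongr
  set ρ := t / s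
  have hρ0 : 0 ≤ ρ := by positivity
  have hρ1 : ρ ≤ 1 := by rw [div_le_one hs0]; linarith
  have hdρ : d * ρ = t * s := by rw [hd]; simp only [ρ]; field_simp
  have hb := bin_nonneg hρ0 hρ1 d
  have hgood (f : ℕ) (hfd : f ≤ d) (hf : ¬ (0.01 * q) ^ 2 ≤ ((f : ℝ) - d * ρ) ^ 2) :
      1 / 2 + 0.456 / t ≤ tail (d - f) (w₀ - f) := by
    rw [hdρ] at hf
    have hf' := abs_lt.1 (abs_lt_of_sq_lt_sq (not_le.1 hf) (by positivity))
    set n := d - f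
    have hm1 : d ≤ 2 * (n / 2) + 1 + f := by omega
    have hm1' : (d : ℝ) ≤ 2 * (n / 2 : ℕ) + 1 + f := by exact_mod_cast hm1
    have hm2 : 2 * (n / 2) ≤ d := by omega
    have hm2' : 2 * ((n / 2 : ℕ) : ℝ) ≤ d := by exact_mod_cast hm2
    rw [hd] at hm1' hm2'
    have hqs : q ≤ s := div_le_self hs0.le (by linarith)
    have hs2 : 10 ^ 7 * s ≤ s ^ 2 := by
      rw [sq]; exact mul_le_mul_of_nonneg_right (by linarith) hs0.le
    have hts2 : 10 ^ 7 * (t * s) ≤ s ^ 2 := by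
      rw [sq, ← mul_assoc]; exact mul_le_mul_of_nonneg_right hst hs0.le
    have hf3 : (f : ℝ) ≤ 0.01 * s ^ 2 := by linarith
    have hm : 0.49 * s ^ 2 ≤ ((n / 2 : ℕ) : ℝ) := by linarith
    set m := n / 2
    have hm0 : (0 : ℝ) < m := lt_of_lt_of_le (by positivity) hm
    -- The cutoff lies 1.2 q below the mean on the scale of 2W, hence 0.6 q on that of W; the
    -- deviation of f and rounding use up the missing 0.01 q.
    set i := ⌊0.59 * q⌋₊
    have hi1 : (i : ℝ) ≤ 0.59 * q := Nat.floor_le (by positivity)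
    have hi2 : 0.58 * q ≤ i := by
      have := Nat.lt_floor_add_one (0.59 * q)
      change (0.59 * q) < i + 1 at this
      linarith
    have him : i ≤ m := by
      have : (i : ℝ) ≤ m := by linarith
      exact_mod_cast this
    have hwi : 2 * w₀ + 2 * i ≤ d + f := by
      have : 2 * (w₀ : ℝ) + 2 * i ≤ d + f := by rw [hd]; linarith
      exact_mod_cast this
    refine le_trans ?_ (half_add_le_tail him (by omega))
    gcongr
    have hsm : (i : ℝ) ^ 2 / m ≤ 0.0001 := by
      rw [div_le_iff₀ hm0]
      have h1 : (i : ℝ) ^ 2 ≤ (0.59 * q) ^ 2 := by gcongr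
      have h2 : q ^ 2 * 10 ^ 14 ≤ s ^ 2 := by
        rw [hsq, mul_pow]
        gcongr
        nlinarith
      nlinarith
    have hcen := le_central (s := s) (m := m) (by linarith)
      (Nat.one_le_iff_ne_zero.2 (by exact_mod_cast hm0.ne')) hm2'
    have hcen0 := (central_pos m).le
    calc 0.456 / t ≤ 0.58 * q * (0.79 / s * (1 - 0.0001)) := by
          rw [hsq]
          field_simp
          norm_num
      _ ≤ i * (central m * (1 - (i : ℝ) ^ 2 / m)) := by
          gcongr
  have hbad : ∑ f ∈ Finset.range (d + 1),
      (if (0.01 * q) ^ 2 ≤ ((f : ℝ) - d * ρ) ^ 2 then bin ρ d f else 0) ≤ 0.001 / t := by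
    refine (sum_bin_le_of_sq_le hρ0 hρ1 d (by positivity) _ fun f hf => hf).trans ?_
    rw [hdρ, hsq, div_le_div_iff₀ (by positivity) ht0]
    have h : 10 ^ 7 * t ^ 3 * q ≤ q * q := by gcongr
    linarith
  have hsmall : 0.456 / t ≤ 1 / 2 := by
    rw [div_le_div_iff₀ ht0 two_pos]; linarith
  calc 1 / 2 + 0.455 / t ≤ (1 / 2 + 0.456 / t) * (1 - 0.001 / t) := by
        have : 0 ≤ 0.001 / t := by positivity
        have e : 0.455 / t = 0.456 / t - 0.001 / t := by ring
        nlinarith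
    _ ≤ (1 / 2 + 0.456 / t) * ∑ f ∈ Finset.range (d + 1), bin ρ d f *
          (1 - if (0.01 * q) ^ 2 ≤ ((f : ℝ) - d * ρ) ^ 2 then 1 else 0) := by
        gcongr
        simp_rw [mul_one_sub, mul_ite, mul_one, mul_zero, Finset.sum_sub_distrib, sum_bin]
        gcongr
    _ ≤ ∑ f ∈ Finset.range (d + 1), bin ρ d f * tail (d - f) (w₀ - f) := by
        rw [Finset.mul_sum]
        refine Finset.sum_le_sum fun f hf => ?_
        rw [mul_left_comm]
        refine mul_le_mul_of_nonneg_left ?_ (hb f)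
        split_ifs with h
        · rw [sub_self, mul_zero]
          exact Finset.sum_nonneg fun v _ => by
            split_ifs
            · exact bin_nonneg (by norm_num) (by norm_num) _ _
            · exact le_rfl
        · rw [sub_zero, mul_one]
          exact hgood f (Nat.lt_succ_iff.1 (Finset.mem_range.1 hf)) h
    _ = ∑ w ∈ Finset.range (d + 1), bin ((1 + ρ) / 2) d w * (if w₀ ≤ w then 1 else 0) := by
        rw [sum_bin_mixture]
        simp_rw [tail, mul_ite, mul_one, mul_zero, tsub_le_iff_left]
    _ = _ := by simp

/-- The nearest neighbor rule succeeds with probability at least one half. -/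
theorem half_le_success_nearestProtocol [NeZero k] {s t : ℝ} (ht : 10 ^ 7 ≤ t) (hs : t ^ 5 ≤ s)
    (hd : (d : ℝ) = s ^ 2) (hk : k * Real.exp (-(t ^ 2 / 2)) ≤ 0.72 * t) :
    1 / 2 ≤ (nearestProtocol k d).success (t / s) := by
  have ht0 : 0 < t := by linarith
  have hq : 10 ^ 7 * t ^ 3 ≤ s := by
    calc 10 ^ 7 * t ^ 3 ≤ t ^ 2 * t ^ 3 := by
          gcongr
          nlinarith
      _ = t ^ 5 := by ring
      _ ≤ s := hs
  have hst : 10 ^ 7 * t ≤ s := by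
    refine le_trans ?_ hq
    gcongr
    exact le_self_pow₀ (by linarith) (by norm_num)
  have hs0 : 0 < s := by linarith
  set ρ := t / s
  have hρ0 : 0 < ρ := by positivity
  have hρ1 : ρ ≤ 0.0000001 := by rw [div_le_iff₀ hs0]; linarith
  have hk1 : (1 : ℝ) ≤ k := by exact_mod_cast NeZero.one_le
  -- At this cutoff the log-likelihood is still at least t²/2 - 1.201. The offset 1.2 makes the
  -- gain, linear in it, exceed the loss, exponential in it.
  set w₀ := ⌈(s ^ 2 + t * s - 1.2 * (s / t)) / 2⌉₊
  have hst' : s / t ≤ s := div_le_self hs0.le (by linarith)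
  have hw1 : (s ^ 2 + t * s - 1.2 * (s / t)) / 2 ≤ w₀ := Nat.le_ceil _
  have hw2 : (w₀ : ℝ) < (s ^ 2 + t * s - 1.2 * (s / t)) / 2 + 1 := Nat.ceil_lt_add_one (by
    nlinarith)
  have hwd : w₀ ≤ d := by
    have : (w₀ : ℝ) ≤ d := by
      have : 0 ≤ s / t := by positivity
      rw [hd]; nlinarith
    exact_mod_cast this
  have hgain := le_sum_bin_of_large ht hs hd (w₀ := w₀) (by linarith)
  have hloss := sum_bin_mul_tail_le hρ0 (by linarith)
    (fun v _ => bin_le_of_large ht hs hd v) hwd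
  have hlik : (lik ρ d w₀)⁻¹ ≤ Real.exp (-(t ^ 2 / 2)) * 3.41 := by
    have hl := (abs_le.1 (abs_log_lik_sub_le hρ0.le (by linarith) hwd)).1
    have hpos := lik_pos hρ0.le (by linarith) d w₀
    rw [← Real.exp_log (inv_pos.2 hpos), Real.log_inv]
    have h1 : t ^ 2 - 1.2 ≤ (2 * w₀ - d) * ρ := by
      have : t * s - 1.2 * (s / t) ≤ 2 * w₀ - d := by rw [hd]; linarith
      calc t ^ 2 - 1.2 = (t * s - 1.2 * (s / t)) * ρ := by simp only [ρ]; field_simp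
        _ ≤ _ := by gcongr
    have h2 : d * ρ ^ 2 / 2 = t ^ 2 / 2 := by rw [hd]; simp only [ρ]; field_simp
    have h3 : 2 * d * ρ ^ 3 ≤ 0.001 := by
      have : 2 * d * ρ ^ 3 = 2 * t ^ 3 / s := by rw [hd]; simp only [ρ]; field_simp
      rw [this, div_le_iff₀ hs0]
      linarith
    calc Real.exp (-Real.log (lik ρ d w₀)) ≤ Real.exp (-(t ^ 2 / 2) + 1.201) :=
          Real.exp_le_exp.2 (by linarith)
      _ = Real.exp (-(t ^ 2 / 2)) * Real.exp 1.201 := Real.exp_add _ _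
      _ ≤ _ := by gcongr; exact exp_one_point_two_zero_one_le
  -- The constant is 0.836² · 0.72 · 3.41 / 4 < 0.44, which has to stay below the gain 0.455.
  have hloss' : k * ∑ w ∈ Finset.range (d + 1),
      (if w₀ ≤ w then bin ((1 + ρ) / 2) d w * tail d w else 0) ≤ 0.44 / t := by
    calc _ ≤ k * ((0.836 / s) ^ 2 * ((1 + ρ) / (2 * ρ)) ^ 2 *
          (Real.exp (-(t ^ 2 / 2)) * 3.41)) := by
          gcongr
          exact hloss.trans (by gcongr)
      _ = (k * Real.exp (-(t ^ 2 / 2))) * ((0.836 / s) ^ 2 * ((1 + ρ) / (2 * ρ)) ^ 2 * 3.41) := by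
          ring
      _ ≤ (0.72 * t) * ((0.836 / s) ^ 2 * ((1 + 0.0000001) / (2 * ρ)) ^ 2 * 3.41) := by
          gcongr
      _ ≤ 0.44 / t := by
          simp only [ρ]
          field_simp
          norm_num
  refine le_trans ?_ (le_success_nearestProtocol hρ0.le (by linarith) w₀)
  have hsplit : ∑ w ∈ Finset.range (d + 1),
      (if w₀ ≤ w then bin ((1 + ρ) / 2) d w * (1 - (k - 1) * tail d w) else 0) =
      ∑ w ∈ Finset.range (d + 1), (if w₀ ≤ w then bin ((1 + ρ) / 2) d w else 0) -
      (k - 1) * ∑ w ∈ Finset.range (d + 1),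
        (if w₀ ≤ w then bin ((1 + ρ) / 2) d w * tail d w else 0) := by
    rw [Finset.mul_sum, ← Finset.sum_sub_distrib]
    refine Finset.sum_congr rfl fun w _ => ?_
    split_ifs
    · ring
    · simp
  have hnonneg : 0 ≤ ∑ w ∈ Finset.range (d + 1),
      (if w₀ ≤ w then bin ((1 + ρ) / 2) d w * tail d w else 0) :=
    Finset.sum_nonneg fun w _ => by
      split_ifs
      · refine mul_nonneg (bin_nonneg (by linarith) (by linarith) _ _)
          (Finset.sum_nonneg fun v _ => ?_)
        split_ifs
        · exact bin_nonneg (by norm_num) (by norm_num) _ _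
        · exact le_rfl
      · exact le_rfl
  rw [hsplit]
  have : 0.44 / t ≤ 0.455 / t := by gcongr; norm_num
  linarith

/-! ### Asymptotics in k and conclusion -/

lemma Protocol.err_nonneg (P : Protocol k d) (T : Task k d) : 0 ≤ P.err T := ENNReal.toReal_nonneg

lemma optErr_le (T : Task k d) (P : Protocol k d) : optErr T ≤ P.err T :=
  ciInf_le ⟨0, by rintro _ ⟨P, rfl⟩; exact P.err_nonneg T⟩ P

/-- The correlation parameter `ρ`, multiplied by `√d`. -/
def scale (a : ℝ) (k : ℕ) : ℝ := √(2 * Real.log (a * k) - Real.log (Real.log k))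

lemma rho_eq (a : ℝ) (k d : ℕ) : rho a k d = scale a k / √d :=
  Real.sqrt_div' _ (Nat.cast_nonneg d)

/-- `k` is so large compared with `a` that the scale obeys all estimates used below. -/
structure IsLarge (a : ℝ) (k : ℕ) : Prop where
  log_pos : 0 < Real.log k
  sq_scale : scale a k ^ 2 = 2 * (Real.log a + Real.log k) - Real.log (Real.log k)
  sq_scale_le : scale a k ^ 2 ≤ 2 * (Real.log k + Real.log a)
  le_scale : 10 ^ 7 ≤ scale a k
  mul_exp_le : k * Real.exp (-(scale a k ^ 2 / 2)) ≤ 0.72 * scale a k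
  pow_scale_le : ∀ d : ℕ, (k : ℝ) ^ (0.1 : ℝ) ≤ d → scale a k ^ 5 ≤ √d

lemma tendsto_log_natCast : Tendsto (fun k : ℕ => Real.log k) atTop atTop :=
  Real.tendsto_log_atTop.comp tendsto_natCast_atTop_atTop

lemma eventually_isLarge {a : ℝ} (ha : 1 < a) : ∀ᶠ k : ℕ in atTop, IsLarge a k := by
  have hla : 0 < Real.log a := Real.log_pos ha
  have h1 := tendsto_log_natCast.eventually_ge_atTop (10 ^ 15)
  -- With l = log k, the quantity k·exp(-t²/2) equals √l/a, while t² ≥ 1.93 l; the value 0.07 is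
  -- small enough for 0.72² · 1.93 > 1.
  have h2 := tendsto_log_natCast.eventually
    (Real.isLittleO_log_id_atTop.bound (show (0 : ℝ) < 0.07 by norm_num))
  have h3 := tendsto_log_natCast.eventually_ge_atTop (Real.log a)
  have h4 := tendsto_log_natCast.eventually
    ((isLittleO_pow_exp_pos_mul_atTop 5 (show (0 : ℝ) < 0.1 by norm_num)).bound
      (show (0 : ℝ) < 1 / 4 ^ 5 by norm_num))
  filter_upwards [h1, h2, h3, h4, eventually_ge_atTop 1] with k h1 h2 h3 h4 hk
  have hk0 : (0 : ℝ) < k := by exact_mod_cast hk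
  set l := Real.log k
  have hl0 : 0 < l := by linarith
  have hll : 0 ≤ Real.log l := Real.log_nonneg (by linarith)
  simp only [id, Real.norm_of_nonneg hll, Real.norm_of_nonneg hl0.le] at h2
  rw [Real.norm_of_nonneg (by positivity), Real.norm_of_nonneg (Real.exp_pos _).le] at h4
  have hsq : scale a k ^ 2 = 2 * (Real.log a + l) - Real.log l := by
    rw [scale, Real.log_mul (by linarith) hk0.ne', Real.sq_sqrt]
    change 0 ≤ 2 * (Real.log a + l) - Real.log l
    linarith
  have hs0 : 0 ≤ scale a k := Real.sqrt_nonneg _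
  refine ⟨hl0, hsq, by linarith, ?_, ?_, fun d hd => ?_⟩
  · refine le_of_sq_le_sq ?_ hs0
    rw [hsq]; linarith
  · have hexp : k * Real.exp (-(scale a k ^ 2 / 2)) = √l / a := by
      have e : -(scale a k ^ 2 / 2) = Real.log l / 2 - (Real.log a + l) := by rw [hsq]; ring
      rw [e, Real.exp_sub, Real.exp_add, Real.exp_log (by linarith), Real.exp_log hk0,
        ← Real.log_sqrt hl0.le, Real.exp_log (Real.sqrt_pos.2 hl0)]
      field_simp
    rw [hexp]
    refine (div_le_self (Real.sqrt_nonneg _) ha.le).trans ?_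
    rw [Real.sqrt_le_left (by positivity), mul_pow, hsq]
    linarith
  · refine Real.le_sqrt_of_sq_le ?_
    calc (scale a k ^ 5) ^ 2 = (scale a k ^ 2) ^ 5 := by ring
      _ ≤ (4 * l) ^ 5 := by
        gcongr
        rw [hsq]; linarith
      _ = 4 ^ 5 * l ^ 5 := by ring
      _ ≤ Real.exp (0.1 * l) := by linarith
      _ = (k : ℝ) ^ (0.1 : ℝ) := by rw [Real.rpow_def_of_pos hk0, mul_comm]
      _ ≤ d := hd

lemma IsLarge.neZero {a : ℝ} (h : IsLarge a k) : NeZero k :=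
  ⟨by rintro rfl; simpa using h.log_pos⟩

lemma IsLarge.scale_mul_le {a : ℝ} (h : IsLarge a k) (hd : (k : ℝ) ^ (0.1 : ℝ) ≤ d) :
    10 ^ 7 * scale a k ^ 3 ≤ √d := by
  have ht := h.le_scale
  calc 10 ^ 7 * scale a k ^ 3 ≤ scale a k ^ 2 * scale a k ^ 3 := by
        gcongr
        nlinarith
    _ = scale a k ^ 5 := by ring
    _ ≤ _ := h.pow_scale_le d hd

lemma IsLarge.scale_le {a : ℝ} (h : IsLarge a k) (hd : (k : ℝ) ^ (0.1 : ℝ) ≤ d) :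
    10 ^ 7 * scale a k ≤ √d := by
  have ht := h.le_scale
  refine le_trans ?_ (h.scale_mul_le hd)
  gcongr
  exact le_self_pow₀ (by linarith) (by norm_num)

lemma IsLarge.sqrt_pos {a : ℝ} (h : IsLarge a k) (hd : (k : ℝ) ^ (0.1 : ℝ) ≤ d) : 0 < √(d : ℝ) := by
  linarith [h.scale_le hd, h.le_scale]

lemma IsLarge.rho_pos {a : ℝ} (h : IsLarge a k) (hd : (k : ℝ) ^ (0.1 : ℝ) ≤ d) :
    0 < rho a k d := by
  rw [rho_eq]
  exact div_pos (by linarith [h.le_scale]) (h.sqrt_pos hd)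

lemma IsLarge.rho_le_half {a : ℝ} (h : IsLarge a k) (hd : (k : ℝ) ^ (0.1 : ℝ) ≤ d) :
    rho a k d ≤ 1 / 2 := by
  rw [rho_eq, div_le_iff₀ (h.sqrt_pos hd)]
  linarith [h.scale_le hd, h.le_scale]

lemma IsLarge.optErr_le_half {a : ℝ} (h : IsLarge a k) (hd : (k : ℝ) ^ (0.1 : ℝ) ≤ d) :
    optErr (nearestNeighbors k d (rho a k d)) ≤ 1 / 2 := by
  have := h.neZero
  have h0 := h.rho_pos hd
  have h1 := h.rho_le_half hd
  refine (optErr_le _ (nearestProtocol k d)).trans ?_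
  rw [Protocol.err_nearestNeighbors _ h0.le (by linarith), rho_eq]
  linarith [half_le_success_nearestProtocol (k := k) h.le_scale (h.pow_scale_le d hd)
    (Real.sq_sqrt (Nat.cast_nonneg d)).symm h.mul_exp_le]

/-- No protocol for a large number of neighbors succeeds much more often than half the time. -/
lemma IsLarge.le_optErr {a δ : ℝ} (h : IsLarge a k) (hd : (k : ℝ) ^ (0.1 : ℝ) ≤ d) (hδ : 0 < δ)
    (hlog : 2 * (Real.log a - Real.log δ + 2) ≤ Real.log (Real.log k))
    (hscale : 1 / δ ≤ scale a k) :
    1 / 2 - 2 * δ ≤ optErr (nearestNeighbors k d (rho a k d)) := by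
  have := h.neZero
  have h0 := h.rho_pos hd
  have h1 := h.rho_le_half hd
  have hne : Nonempty (Protocol k d) := ⟨nearestProtocol k d⟩
  refine le_ciInf fun P => ?_
  rw [P.err_nearestNeighbors h0.le (by linarith)]
  have ht := h.le_scale
  have hs0 := h.sqrt_pos hd
  have hcube := h.scale_mul_le hd
  have hrho := rho_eq a k d
  have hsd : (d : ℝ) = √(d : ℝ) ^ 2 := (Real.sq_sqrt (Nat.cast_nonneg d)).symm
  set s := √(d : ℝ)
  set t := scale a k with ht_def
  set ρ := rho a k d
  have ht0 : 0 < t := by linarith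
  have hk0 : (0 : ℝ) < k := by exact_mod_cast NeZero.pos k
  have hdρ : d * ρ = t * s := by rw [hsd, hrho]; field_simp
  -- The term -ln ln k in the scale acts here: ln(δk) + t²/2 = t² + ln δ - ln a + (ln ln k)/2, which
  -- is at least t² + 2.
  have hcut (w : ℕ) (hw : w ≤ d) (hτ : δ * k < lik ρ d w) : d * ρ + s / t < 2 * w - d := by
    have hl := Real.log_lt_log (by positivity) hτ
    rw [Real.log_mul hδ.ne' hk0.ne'] at hl
    have hb := (abs_le.1 (abs_log_lik_sub_le h0.le h1 hw)).2
    have h2 : d * ρ ^ 2 / 2 = t ^ 2 / 2 := by rw [hsd, hrho]; field_simp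
    have h3 : 2 * d * ρ ^ 3 ≤ 0.001 := by
      have : 2 * d * ρ ^ 3 = 2 * t ^ 3 / s := by rw [hsd, hrho]; field_simp
      rw [this, div_le_iff₀ hs0]
      linarith
    have hsq := h.sq_scale
    rw [← ht_def] at hsq
    have h4 : t ^ 2 + 1 < (2 * w - d) * ρ := by linarith
    rw [hdρ]
    have e : t * s + s / t = (t ^ 2 + 1) / ρ := by rw [hrho]; field_simp
    rw [e, div_lt_iff₀ h0]
    exact h4
  have hup := P.success_le h0.le (by linarith : ρ ≤ 1) (τ := δ * k) (by positivity)
  have hmid := sum_lik_gt_le h0.le (by linarith : ρ ≤ 1) (by positivity) hcut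
  have hsm : d * ρ / (s / t) ^ 2 ≤ δ := by
    rw [hdρ]
    have e : t * s / (s / t) ^ 2 = t ^ 3 / s := by field_simp
    rw [e, div_le_iff₀ hs0]
    have h5 : 1 ≤ δ * t := by rwa [div_le_iff₀' hδ] at hscale
    have h6 : t ^ 5 ≤ s := h.pow_scale_le d hd
    calc t ^ 3 ≤ (δ * t) * t ^ 4 := by
          have : t ^ 3 ≤ t ^ 4 := pow_le_pow_right₀ (by linarith) (by norm_num)
          nlinarith [pow_pos ht0 4]
      _ = δ * t ^ 5 := by ring
      _ ≤ δ * s := by gcongr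
  rw [mul_div_cancel_right₀ _ hk0.ne'] at hup
  linarith

/-- The information lower bound for suboptimal protocols. -/
lemma IsLarge.le_info {a ε : ℝ} (ha : 1 < a) (h : IsLarge a k) (hd : (k : ℝ) ^ (0.1 : ℝ) ≤ d)
    {P : Protocol k d} (hP : P.IsSuboptimal (nearestNeighbors k d (rho a k d)) ε) :
    ENNReal.ofReal ((1 - 1 / 2 - ε - (Real.log k)⁻¹) /
      (2 * Real.log 2 + 2 * Real.log 2 * Real.log a * (Real.log k)⁻¹) * (k * d)) ≤
      P.info (nearestNeighbors k d (rho a k d)) := by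
  have := h.neZero
  have h0 := h.rho_pos hd
  have h1 := h.rho_le_half hd
  have hl := h.log_pos
  have hla := Real.log_pos ha
  have hl2 : 0 < Real.log 2 := Real.log_pos (by norm_num)
  have hS : 1 / 2 - ε ≤ P.success (rho a k d) := by
    have := hP.trans (add_le_add_left (h.optErr_le_half hd) ε)
    rw [P.err_nearestNeighbors h0.le (by linarith)] at this
    linarith
  have hinfo := P.le_klDiv_of_success h0 (by linarith : rho a k d ≤ 1)
  rw [Protocol.info]
  refine le_trans ?_ (ENNReal.div_le_div_right hinfo _)
  rw [← ENNReal.ofReal_div_of_pos hl2]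
  -- For a nonpositive numerator the claimed bound is 0; otherwise the denominator may be enlarged.
  rcases le_or_gt (1 - 1 / 2 - ε - (Real.log k)⁻¹) 0 with hA | hA
  · refine le_trans (le_of_eq (ENNReal.ofReal_of_nonpos ?_)) zero_le
    exact mul_nonpos_of_nonpos_of_nonneg (div_nonpos_of_nonpos_of_nonneg hA (by positivity))
      (by positivity)
  refine ENNReal.ofReal_le_ofReal ?_
  have hrho := rho_eq a k d
  have hs0 := h.sqrt_pos hd
  have hsd : (d : ℝ) = √(d : ℝ) ^ 2 := (Real.sq_sqrt (Nat.cast_nonneg d)).symm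
  have ht0 : 0 < scale a k := by linarith [h.le_scale]
  have hk0 : (0 : ℝ) < k := by exact_mod_cast NeZero.pos k
  set A := 1 - 1 / 2 - ε - (Real.log k)⁻¹
  set l := Real.log k
  have hSl : A * l ≤ P.success (rho a k d) * l - 1 := by
    have : A * l = (1 / 2 - ε) * l - 1 := by
      change (1 - 1 / 2 - ε - l⁻¹) * l = _
      linear_combination -(inv_mul_cancel₀ hl.ne')
    rw [this]
    gcongr
  have hd0 : (0 : ℝ) < d := by rw [hsd]; positivity
  have hsq : 1 / rho a k d ^ 2 = d / scale a k ^ 2 := by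
    rw [hrho, div_pow, Real.sq_sqrt hd0.le, one_div_div]
  calc A / (2 * Real.log 2 + 2 * Real.log 2 * Real.log a * l⁻¹) * (k * d)
      = d / (2 * (l + Real.log a)) * (k * (A * l)) / Real.log 2 := by
        field_simp
    _ ≤ d / scale a k ^ 2 * (k * (A * l)) / Real.log 2 := by
        gcongr
        exact h.sq_scale_le
    _ ≤ d / scale a k ^ 2 * (k * P.success (rho a k d) * l - (k - 1)) / Real.log 2 := by
        gcongr
        nlinarith
    _ = _ := by rw [hsq]

end

end OneWay

theorem mainTheorem8 (a : ℝ) (ha : 1 < a) :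
    ∃ (c : ℝ) (o₁ o₂ : ℕ → ℝ),
      0 < c ∧ c < 1 ∧
      (∀ δ : ℝ, 0 < δ → ∀ᶠ k : ℕ in atTop, ∀ d : ℕ, (k : ℝ) ^ (0.1 : ℝ) ≤ d →
        |OneWay.optErr (OneWay.nearestNeighbors k d (OneWay.rho a k d)) - c| < δ ∧
        |OneWay.optErr (OneWay.singletonsHC k d (OneWay.rho a k d)) - c| < δ) ∧
      o₁ =O[atTop] (fun k : ℕ => (Real.log k)⁻¹) ∧
      o₂ =O[atTop] (fun k : ℕ => (Real.log k)⁻¹) ∧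
      ∀ᶠ k : ℕ in atTop, ∀ d : ℕ, (k : ℝ) ^ (0.1 : ℝ) ≤ d →
        ∀ ε : ℝ, 0 ≤ ε → ∀ P : OneWay.Protocol k d,
          (P.IsSuboptimal (OneWay.nearestNeighbors k d (OneWay.rho a k d)) ε →
            ENNReal.ofReal ((1 - c - ε - o₁ k) / (2 * Real.log 2 + o₂ k) * (k * d)) ≤
              P.info (OneWay.nearestNeighbors k d (OneWay.rho a k d))) ∧
          (P.IsSuboptimal (OneWay.singletonsHC k d (OneWay.rho a k d)) ε →
            P.IsSuboptimal (OneWay.nearestNeighbors k d (OneWay.rho a k d)) ε ∧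
            P.info (OneWay.singletonsHC k d (OneWay.rho a k d)) =
              P.info (OneWay.nearestNeighbors k d (OneWay.rho a k d)) ∧
            ENNReal.ofReal ((1 - c - ε - o₁ k) / (2 * Real.log 2 + o₂ k) * (k * d)) ≤
              P.info (OneWay.singletonsHC k d (OneWay.rho a k d))) := by
  refine ⟨1 / 2, fun k => (Real.log k)⁻¹,
    fun k => 2 * Real.log 2 * Real.log a * (Real.log k)⁻¹, by norm_num, by norm_num, ?_,
    Asymptotics.isBigO_refl _ _, Asymptotics.isBigO_const_mul_self _ _ _, ?_⟩
  · intro δ hδ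
    -- `IsLarge.le_optErr` loses twice its parameter, so δ/3 leaves a strict inequality.
    have h2 := (Real.tendsto_log_atTop.comp OneWay.tendsto_log_natCast).eventually_ge_atTop
      (max (2 * (Real.log a - Real.log (δ / 3) + 2)) 0)
    have h3 := OneWay.tendsto_log_natCast.eventually_ge_atTop ((1 / (δ / 3)) ^ 2)
    have h4 := OneWay.tendsto_log_natCast.eventually
      (Real.isLittleO_log_id_atTop.bound (show (0 : ℝ) < 1 by norm_num))
    filter_upwards [OneWay.eventually_isLarge ha, h2, h3, h4] with k hk h2 h3 h4 d hd
    have hrho0 := hk.rho_pos hd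
    have hrho1 := hk.rho_le_half hd
    rw [OneWay.singletonsHC_eq_nearestNeighbors hrho0.le (by linarith), and_self, abs_lt]
    have hup := hk.optErr_le_half hd
    have hscale : 1 / (δ / 3) ≤ OneWay.scale a k := by
      refine le_of_sq_le_sq (h3.trans ?_) (Real.sqrt_nonneg _)
      have hll : 0 ≤ Real.log (Real.log k) := (le_max_right _ _).trans h2
      simp only [id, Real.norm_of_nonneg hll, Real.norm_of_nonneg hk.log_pos.le, one_mul] at h4
      rw [hk.sq_scale]
      linarith [Real.log_pos ha]
    have hlow := hk.le_optErr hd (by positivity : 0 < δ / 3) ((le_max_left _ _).trans h2) hscale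
    constructor <;> linarith
  · filter_upwards [OneWay.eventually_isLarge ha] with k hk d hd ε _ P
    have hrho0 := hk.rho_pos hd
    have hrho1 := hk.rho_le_half hd
    rw [OneWay.singletonsHC_eq_nearestNeighbors hrho0.le (by linarith)]
    exact ⟨fun hP => hk.le_info ha hd hP, fun hP => ⟨hP, rfl, hk.le_info ha hd hP⟩⟩
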